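/- Let $G$ be a finite connected undirected graph without multiple edges (self-loops are allowed). A walk on $G$ is a nonempty word $p=p_0p_1\cdots p_l$ of vertices with $p_i,p_{i+1}$ adjacent for all $i<l$; its length is $l$. It is a cycle if $p_0=p_l$, and a cycle is simple if $i<j$ and $p_i=p_j$ imply $i=0$ and $j=l$. A walk is non-backtracking if it has no subword of the form $aba$; $\varphi(p)$ denotes the non-backtracking walk obtained from $p$ by successively replacing subwords $aba$ by $a$ until there is none left. A square is a non-backtracking cycle of length $4$. Two non-backtracking walks $p,q$ differ by a square if, up to exchanging $p$ and $q$, $q=\varphi(p_0\cdots p_{k-1}\,s\,p_{k+1}\cdots p_l)$ for some position $0\le k\le l$ and some square $s$ with $s_0=p_k$. A cycle $c$ is decomposable into squares if there is a finite sequence of non-backtracking walks from $c$ to a walk of length $0$ in which consecutive walks differ by a square. Let $X_G$ be the Hom shift of $G$, i.e. the set of maps $x:\mathbb{Z}^2\to V_G$ such that $x_u$ and $x_v$ are adjacent in $G$ whenever $|u_1-v_1|+|u_2-v_2|=1$. For $f:\{1,2,\dots\}\to\{0,1,2,\dots\}$ and an integer $k\ge1$, $X_G$ is $(f,k)$-phased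 block gluing if for every $n\ge 1$, all patterns $p,p'$ on $\{0,\dots,n-1\}^2$ which appear in elements of $X_G$, and all $u,u'\in\mathbb{Z}^2$ such that the blocks $u+\{0,\dots,n-1\}^2$ and $u'+\{0,\dots,n-1\}^2$ are at $\|\cdot\|_\infty$-distance at least $f(n)$, there are $x\in X_G$ and $v\in\mathbb{Z}^2$ with $\|v\|_\infty<k$ such that $x$ restricted to $u+\{0,\dots,n-1\}^2$ is $p$ and $x$ restricted to $u'+v+\{0,\dots,n-1\}^2$ is $p'$. Let $\theta$ be the least $k\ge1$ such that $X_G$ is $(f,k)$-phased block gluing for some $f$, and let the gap function $\gamma_G$ be the pointwise least function such that $X_G$ is $(\gamma_G,\theta)$-phased block gluing. **Theorem.** If every non-backtracking simple cycle of $G$ is decomposable into squares, then $\theta$ and $\gamma_G$ exist and $\gamma_G(n)=O(\log n)$, that is, there are constants $c,K>0$ such that $\gamma_G(n)\le c\log n+K$ for all $n\ge1$. -/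

import Mathlib

/-- An undirected graph without multiple edges on the vertex set `V`; self-loops are allowed. -/
structure LoopGraph (V : Type*) where
  /-- the adjacency relation -/
  Adj : V → V → Prop
  /-- edges are undirected -/
  symm : ∀ a b, Adj a b → Adj b a

namespace LoopGraph

variable {V : Type*}

/-- Any two vertices are joined by a walk, and there is at least one vertex. -/
def Connected (G : LoopGraph V) : Prop :=
  Nonempty V ∧ ∀ a b, Relation.ReflTransGen G.Adj a b

/-- A walk is a nonempty word `p₀ p₁ … p_l` of vertices whose consecutive letters are adjacent.
Its length `l` is the number of letters minus one. -/
def IsWalk (G : LoopGraph V) (p : List V) : Prop :=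
  p ≠ [] ∧ p.IsChain G.Adj

/-- A cycle is a walk whose first and last letters coincide. -/
def IsCycle (G : LoopGraph V) (c : List V) : Prop :=
  G.IsWalk c ∧ c.head? = c.getLast?

/-- A cycle is simple when the only two distinct positions that may carry the same vertex are the
first one and the last one. -/
def IsSimpleCycle (G : LoopGraph V) (p : List V) : Prop :=
  G.IsCycle p ∧
    ∀ i j : ℕ, i < j → j < p.length → p[i]? = p[j]? → i = 0 ∧ j + 1 = p.length

/-- A walk is non-backtracking when no spine `a b a` is a subword of it. -/
def NonBacktracking (p : List V) : Prop :=
  ∀ a b : V, ¬ [a, b, a] <:+: p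

/-- `q` is obtained from `p` by replacing one spine `a b a` by `a`. -/
def SpineStep (p q : List V) : Prop :=
  ∃ (x y : List V) (a b : V), p = x ++ [a, b, a] ++ y ∧ q = x ++ [a] ++ y

/-- `q = φ(p)`: the word `q` is obtained from `p` by replacing spines `a b a` by `a` successively
until there is none left. -/
def IsReductionOf (q p : List V) : Prop :=
  Relation.ReflTransGen SpineStep p q ∧ NonBacktracking q

/-- A square is a non-backtracking cycle of length four (hence a word of five letters). -/
def IsSquare (G : LoopGraph V) (s : List V) : Prop :=
  G.IsCycle s ∧ s.length = 5 ∧ NonBacktracking s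

/-- The word `p ⊕ₖ s`: the letter of `p` at position `k` is replaced by the word `s`. -/
def insertAt (p : List V) (k : ℕ) (s : List V) : List V :=
  p.take k ++ s ++ p.drop (k + 1)

/-- `q = φ(p ⊕ₖ s)` for some square `s` and some position `k` of `p` with `p_k = s₀`. -/
def AddSquare (G : LoopGraph V) (p q : List V) : Prop :=
  ∃ (k : ℕ) (s : List V), G.IsSquare s ∧ k < p.length ∧ p[k]? = s.head? ∧
    IsReductionOf q (insertAt p k s)

/-- Two non-backtracking walks differ by a square. -/
def DifferBySquare (G : LoopGraph V) (p q : List V) : Prop :=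
  (G.IsWalk p ∧ NonBacktracking p) ∧ (G.IsWalk q ∧ NonBacktracking q) ∧
    (G.AddSquare p q ∨ G.AddSquare q p)

/-- There is a finite sequence of non-backtracking walks from `c` to an empty cycle (a one-letter
word) in which consecutive walks differ by a square. -/
def IsDecomposable (G : LoopGraph V) (c : List V) : Prop :=
  ∃ v : V, Relation.ReflTransGen G.DifferBySquare c [v]

/-- Every simple cycle is decomposable into squares. The only simple cycles that backtrack are the
spines `a b a`; since decompositions are made of non-backtracking walks, they are left out. -/
def SquareDecomposable (G : LoopGraph V) : Prop :=
  ∀ c : List V, G.IsSimpleCycle c → NonBacktracking c → G.IsDecomposable c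

/-- The two-dimensional Hom shift of `G`: all graph homomorphisms from the square grid
to `G` (vertices of the grid that differ by a unit vector are neighbours). -/
def homShift (G : LoopGraph V) : Set (ℤ × ℤ → V) :=
  {x | ∀ u v : ℤ × ℤ, |u.1 - v.1| + |u.2 - v.2| = 1 → G.Adj (x u) (x v)}

end LoopGraph

namespace BlockGluing

variable {A : Type*}

/-- The norm `‖v‖_∞` on `ℤ²`. -/
def supNorm (v : ℤ × ℤ) : ℕ := max v.1.natAbs v.2.natAbs

/-- The distance between two (nonempty) subsets of `ℤ²`, for the norm `‖·‖_∞`. -/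
noncomputable def setDist (U U' : Set (ℤ × ℤ)) : ℕ :=
  sInf {d | ∃ u ∈ U, ∃ u' ∈ U', d = supNorm (u - u')}

/-- The block `u + ⟦0, n - 1⟧²`. -/
def block (n : ℕ+) (u : ℤ × ℤ) : Set (ℤ × ℤ) :=
  {w | ∃ i j : Fin n, w = u + ((i : ℤ), (j : ℤ))}

/-- The block pattern `p` of size `n` is the restriction of `x` to `u + ⟦0, n - 1⟧²`. -/
def AppearsAt {n : ℕ+} (p : Fin n × Fin n → A) (x : ℤ × ℤ → A) (u : ℤ × ℤ) : Prop :=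
  ∀ i j : Fin n, x (u + ((i : ℤ), (j : ℤ))) = p (i, j)

/-- The pattern appears in some element of `X`. -/
def GloballyAdmissible (X : Set (ℤ × ℤ → A)) {n : ℕ+} (p : Fin n × Fin n → A) : Prop :=
  ∃ x ∈ X, ∃ u, AppearsAt p x u

/-- `X` is `(f, k)`-phased block gluing. -/
def IsPhasedGluing (X : Set (ℤ × ℤ → A)) (f : ℕ+ → ℕ) (k : ℕ) : Prop :=
  ∀ (n : ℕ+) (p p' : Fin n × Fin n → A),
    GloballyAdmissible X p → GloballyAdmissible X p' →
    ∀ u u' : ℤ × ℤ, f n ≤ setDist (block n u) (block n u') →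
      ∃ x ∈ X, ∃ v : ℤ × ℤ, supNorm v < k ∧ AppearsAt p x u ∧ AppearsAt p' x (u' + v)

/-- `k` is the phase of `X`: the least positive integer such that `X` is `(f, k)`-phased block
gluing for some `f`. -/
def IsPhase (X : Set (ℤ × ℤ → A)) (k : ℕ) : Prop :=
  IsLeast {k : ℕ | 1 ≤ k ∧ ∃ f : ℕ+ → ℕ, IsPhasedGluing X f k} k

/-- `X` is phased block gluing and `γ` is its gap function: with `θ` the phase of `X`, it is the
pointwise least function for which `X` is `(γ, θ)`-phased block gluing. -/
def IsGapFunction (X : Set (ℤ × ℤ → A)) (γ : ℕ+ → ℕ) : Prop :=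
  ∃ θ : ℕ, IsPhase X θ ∧ IsLeast {f : ℕ+ → ℕ | IsPhasedGluing X f θ} γ

end BlockGluing

/-! Removing a spine and replacing a single letter of a walk generate a homotopy relation with fixed
end points, and adding a square is a homotopy. Cutting a closed walk at repeated vertices reduces it
to simple cycles, so under the hypothesis every closed walk contracts, and two walks with the same
ends are homotopic (`SquareDecomposable.htpy`).

Homotopies are performed by successive rows of a configuration. A row is always compatible with its
own shift by one, so a deformation `w'` of `w` is reached through the shift of `w`; a left shift
followed by a right shift prevents drift. Changes of length are absorbed by an alternating stretch
of the row, its "room". There are finitely many words of a given length, so bounded time and bounded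
room suffice to turn any of them into at most `D` letters followed by alternation
(`SquareDecomposable.exists_compress`).

The logarithm comes from divide and conquer (`SquareDecomposable.exists_contract`). Room is carried
over any distance in a time depending only on its size, because one shift moves a whole segment. A
bounded room is enlarged, part of it is carried to the middle, both halves are contracted in
parallel, and the two short remainders are merged. Each doubling of the length thus costs a constant
number of rows.

A block is extended so as to alternate around it; its boundary row then becomes fully alternating in
`O(log n)` rows, and two alternating rows are joined along a walk of bounded length, up to a shift
by 0 or 1. This shift is unavoidable when the Hom shift is nonempty: homotopy preserves the parity
of length, so closed walks are even and the phase is 2. -/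

/-- The `n`-fold composition of a relation with itself. -/
def IterRel {α : Type*} (R : α → α → Prop) : ℕ → α → α → Prop
  | 0 => Eq
  | n + 1 => Relation.Comp (IterRel R n) R

namespace IterRel

variable {α : Type*} {R : α → α → Prop}

theorem one {a b : α} (h : R a b) : IterRel R 1 a b := ⟨a, rfl, h⟩

theorem trans {m n : ℕ} {a b c : α} (h₁ : IterRel R m a b) (h₂ : IterRel R n b c) :
    IterRel R (m + n) a c := by
  induction n generalizing c with
  | zero => cases h₂; exact h₁
  | succ n ih =>
    obtain ⟨d, hd, hdc⟩ := h₂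
    exact ⟨d, ih hd, hdc⟩

theorem symm (hR : ∀ a b, R a b → R b a) {n : ℕ} {a b : α} (h : IterRel R n a b) :
    IterRel R n b a := by
  induction n generalizing b with
  | zero => exact Eq.symm h
  | succ n ih =>
    obtain ⟨d, hd, hdb⟩ := h
    have := (one (hR _ _ hdb)).trans (ih hd)
    rwa [Nat.add_comm] at this

theorem mono {S : α → α → Prop} (hRS : ∀ a b, R a b → S a b) {n : ℕ} {a b : α}
    (h : IterRel R n a b) : IterRel S n a b := by
  induction n generalizing b with
  | zero => exact h
  | succ n ih =>
    obtain ⟨d, hd, hdb⟩ := h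
    exact ⟨d, ih hd, hRS _ _ hdb⟩

theorem mul {S : α → α → Prop} {k : ℕ} {P : α → Prop} (hP : ∀ a b, P a → R a b → P b)
    (hRS : ∀ a b, P a → R a b → IterRel S k a b) {n : ℕ} {a b : α} (ha : P a)
    (h : IterRel R n a b) : P b ∧ IterRel S (k * n) a b := by
  induction n generalizing b with
  | zero => cases h; exact ⟨ha, rfl⟩
  | succ n ih =>
    obtain ⟨d, hd, hdb⟩ := h
    obtain ⟨h₁, h₂⟩ := ih hd
    exact ⟨hP _ _ h₁ hdb, h₂.trans (hRS _ _ h₁ hdb)⟩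

theorem exists_seq {n : ℕ} {a b : α} (h : IterRel R n a b) :
    ∃ F : ℕ → α, F 0 = a ∧ F n = b ∧ ∀ s < n, R (F s) (F (s + 1)) := by
  induction n generalizing b with
  | zero => exact ⟨fun _ => a, rfl, h, by simp⟩
  | succ n ih =>
    obtain ⟨d, hd, hdb⟩ := h
    obtain ⟨F, h0, hn, hs⟩ := ih hd
    refine ⟨fun s => if s ≤ n then F s else b, by simpa using h0, by simp, fun s hsn => ?_⟩
    rcases Nat.lt_succ_iff_lt_or_eq.mp hsn with h | rfl
    · simpa [h.le, Nat.succ_le_of_lt h] using hs s h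
    · simpa [hn] using hdb

theorem of_seq {n : ℕ} (F : ℕ → α) (h : ∀ s < n, R (F s) (F (s + 1))) :
    IterRel R n (F 0) (F n) := by
  induction n with
  | zero => rfl
  | succ n ih => exact ⟨F n, ih fun s hs => h s (by omega), h n (by omega)⟩

end IterRel

/-! ### Rows, local moves on rows, and moves in parallel -/

namespace LoopGraph

variable {V : Type*} {G : LoopGraph V}

/-- A bi-infinite walk. -/
def IsRow (G : LoopGraph V) (w : ℤ → V) : Prop := ∀ i, G.Adj (w i) (w (i + 1))

/-- On the interval `[a, b]` the row alternates between two letters. -/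
def Alt (w : ℤ → V) (a b : ℤ) : Prop := ∀ i, a ≤ i → i + 2 ≤ b → w (i + 2) = w i

theorem Alt.mono {w : ℤ → V} {a b a' b' : ℤ} (h : Alt w a b) (ha : a ≤ a') (hb : b' ≤ b) :
    Alt w a' b' := fun i h₁ h₂ => h i (by omega) (by omega)

theorem Alt.congr {w w' : ℤ → V} {a b : ℤ} (h : Alt w a b)
    (hw : ∀ i, a ≤ i → i ≤ b → w' i = w i) : Alt w' a b := fun i h₁ h₂ => by
  rw [hw i h₁ (by omega), hw (i + 2) (by omega) h₂, h i h₁ h₂]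

theorem Alt.of_short {w : ℤ → V} {a b : ℤ} (h : b < a + 2) : Alt w a b :=
  fun i h₁ h₂ => by omega

theorem Alt.join {w : ℤ → V} {a b c d : ℤ} (h₁ : Alt w a b) (h₂ : Alt w c d) (h : c < b) :
    Alt w a d := fun i hi₁ hi₂ => by
  by_cases hc : c ≤ i
  · exact h₂ i hc hi₂
  · exact h₁ i hi₁ (by omega)

theorem Alt.eq_right {w : ℤ → V} {a b : ℤ} (h : Alt w a b) (m : ℕ) (hm : a ≤ b - 2 * m) :
    w (b - 2 * m) = w b := by
  induction m with
  | zero => simp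
  | succ m ih =>
    push_cast at hm ⊢
    rw [← ih (by omega), ← h (b - 2 * (m + 1)) hm (by omega)]
    congr 1; ring

theorem Alt.eq_of_even {w : ℤ → V} {a b i : ℤ} (h : Alt w a b) (hi : a ≤ i) (hib : i ≤ b)
    (he : (b - i) % 2 = 0) : w i = w b := by
  have := h.eq_right ((b - i) / 2).toNat (by omega)
  rwa [show b - 2 * (((b - i) / 2).toNat : ℤ) = i by omega] at this

/-- Rows `w`, `w'` such that `w, σ w, w'` are successive rows of a configuration, where `σ` is the
left shift, and such that `w'` differs from `w` strictly between `A` and `B` only. -/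
structure LStep (G : LoopGraph V) (A B : ℤ) (w w' : ℤ → V) : Prop where
  row : G.IsRow w'
  diag : ∀ i, G.Adj (w' i) (w (i + 1))
  supp : ∀ i, i ≤ A ∨ B ≤ i → w' i = w i

/-- The mirror image of `LStep`, with the right shift instead of the left one. -/
structure RStep (G : LoopGraph V) (A B : ℤ) (w w' : ℤ → V) : Prop where
  row : G.IsRow w'
  diag : ∀ i, G.Adj (w i) (w' (i + 1))
  supp : ∀ i, i ≤ A ∨ B ≤ i → w' i = w i

/-- A left step followed by a right step. -/
def Step (G : LoopGraph V) (A B : ℤ) (w w' : ℤ → V) : Prop :=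
  ∃ v, G.LStep A B w v ∧ G.RStep A B v w'

/-- `w'` is obtained from `w` in `n` steps that take place between `A` and `B`. -/
def Reach (G : LoopGraph V) (n : ℕ) (A B : ℤ) : (ℤ → V) → (ℤ → V) → Prop :=
  IterRel (G.Step A B) n

theorem LStep.refl {A B : ℤ} {w : ℤ → V} (h : G.IsRow w) : G.LStep A B w w :=
  ⟨h, h, fun _ _ => rfl⟩

theorem RStep.refl {A B : ℤ} {w : ℤ → V} (h : G.IsRow w) : G.RStep A B w w :=
  ⟨h, h, fun _ _ => rfl⟩

theorem LStep.reach {A B : ℤ} {w w' : ℤ → V} (h : G.LStep A B w w') : G.Reach 1 A B w w' :=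
  IterRel.one ⟨w', h, RStep.refl h.row⟩

theorem RStep.reach {A B : ℤ} {w w' : ℤ → V} (hw : G.IsRow w) (h : G.RStep A B w w') :
    G.Reach 1 A B w w' :=
  IterRel.one ⟨w, LStep.refl hw, h⟩

theorem Step.supp {A B : ℤ} {w w' : ℤ → V} (h : G.Step A B w w') (i : ℤ)
    (hi : i ≤ A ∨ B ≤ i) : w' i = w i := by
  obtain ⟨v, h₁, h₂⟩ := h
  rw [h₂.supp i hi, h₁.supp i hi]

theorem Step.mono {A B A' B' : ℤ} {w w' : ℤ → V} (hA : A' ≤ A) (hB : B ≤ B')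
    (h : G.Step A B w w') : G.Step A' B' w w' := by
  obtain ⟨v, h₁, h₂⟩ := h
  exact ⟨v, ⟨h₁.row, h₁.diag, fun i hi => h₁.supp i (by omega)⟩,
    ⟨h₂.row, h₂.diag, fun i hi => h₂.supp i (by omega)⟩⟩

theorem Reach.mono {n : ℕ} {A B A' B' : ℤ} {w w' : ℤ → V} (h : G.Reach n A B w w')
    (hA : A' ≤ A) (hB : B ≤ B') : G.Reach n A' B' w w' :=
  IterRel.mono (fun _ _ => Step.mono hA hB) h

theorem Reach.supp {n : ℕ} {A B : ℤ} {w w' : ℤ → V} (h : G.Reach n A B w w') (i : ℤ)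
    (hi : i ≤ A ∨ B ≤ i) : w' i = w i := by
  induction n generalizing w' with
  | zero => cases h; rfl
  | succ n ih =>
    obtain ⟨v, h₁, h₂⟩ := h
    rw [h₂.supp i hi, ih h₁]

theorem Reach.row {n : ℕ} {A B : ℤ} {w w' : ℤ → V} (h : G.Reach n A B w w') (hw : G.IsRow w) :
    G.IsRow w' := by
  cases n with
  | zero => cases h; exact hw
  | succ n =>
    obtain ⟨v, h₁, ⟨u, _, h₂⟩⟩ := h
    exact h₂.row

theorem Reach.trans {m n : ℕ} {A B : ℤ} {w w' w'' : ℤ → V} (h₁ : G.Reach m A B w w')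
    (h₂ : G.Reach n A B w' w'') : G.Reach (m + n) A B w w'' :=
  IterRel.trans h₁ h₂

theorem Reach.refl {A B : ℤ} {w : ℤ → V} (h : G.IsRow w) (n : ℕ) : G.Reach n A B w w := by
  induction n with
  | zero => rfl
  | succ n ih => exact ih.trans (LStep.refl h).reach

theorem Reach.le {m n : ℕ} {A B : ℤ} {w w' : ℤ → V} (h : G.Reach m A B w w') (hw : G.IsRow w)
    (hmn : m ≤ n) : G.Reach n A B w w' := by
  obtain ⟨k, rfl⟩ := Nat.exists_eq_add_of_le hmn
  exact h.trans (Reach.refl (h.row hw) k)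

/-- The row equal to `f` up to position `B` and to `g` after it. -/
def glueAt (B : ℤ) (f g : ℤ → V) (i : ℤ) : V := if i ≤ B then f i else g i

theorem glueAt_left {B i : ℤ} {f g : ℤ → V} (h : i ≤ B) : glueAt B f g i = f i := if_pos h

theorem glueAt_right {B i : ℤ} {f g : ℤ → V} (hB : f B = g B) (h : B ≤ i) :
    glueAt B f g i = g i := by
  rcases h.eq_or_lt with rfl | h
  · rw [glueAt_left le_rfl, hB]
  · exact if_neg (by omega)

theorem IsRow.glueAt {B : ℤ} {f g : ℤ → V} (hf : G.IsRow f) (hg : G.IsRow g) (hB : f B = g B) :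
    G.IsRow (glueAt B f g) := fun i => by
  rcases lt_or_ge i B with h | h
  · rw [glueAt_left h.le, glueAt_left (by omega)]; exact hf i
  · rw [glueAt_right hB h, glueAt_right hB (by omega)]; exact hg i

theorem LStep.glueAt {A B C : ℤ} {f f' g g' : ℤ → V} (hAB : A ≤ B) (hBC : B ≤ C)
    (hf : G.LStep A B f f') (hg : G.LStep B C g g') (hB : f B = g B) :
    G.LStep A C (glueAt B f g) (glueAt B f' g') := by
  have hB' : f' B = g' B := by rw [hf.supp B (by omega), hg.supp B (by omega), hB]
  refine ⟨hf.row.glueAt hg.row hB', fun i => ?_, fun i hi => ?_⟩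
  · rcases lt_or_ge i B with h | h
    · rw [glueAt_left h.le, glueAt_left (by omega)]; exact hf.diag i
    · rw [glueAt_right hB' h, glueAt_right hB (by omega)]; exact hg.diag i
  · rcases lt_or_ge i B with h | h
    · rw [glueAt_left h.le, glueAt_left h.le, hf.supp i (by omega)]
    · rw [glueAt_right hB' h, glueAt_right hB h, hg.supp i (by omega)]

theorem RStep.glueAt {A B C : ℤ} {f f' g g' : ℤ → V} (hAB : A ≤ B) (hBC : B ≤ C)
    (hf : G.RStep A B f f') (hg : G.RStep B C g g') (hB : f B = g B) :
    G.RStep A C (glueAt B f g) (glueAt B f' g') := by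
  have hB' : f' B = g' B := by rw [hf.supp B (by omega), hg.supp B (by omega), hB]
  refine ⟨hf.row.glueAt hg.row hB', fun i => ?_, fun i hi => ?_⟩
  · rcases lt_or_ge i B with h | h
    · rw [glueAt_left h.le, glueAt_left (by omega)]; exact hf.diag i
    · rw [glueAt_right hB h, glueAt_right hB' (by omega)]; exact hg.diag i
  · rcases lt_or_ge i B with h | h
    · rw [glueAt_left h.le, glueAt_left h.le, hf.supp i (by omega)]
    · rw [glueAt_right hB' h, glueAt_right hB h, hg.supp i (by omega)]

/-- Deformations of two consecutive segments can be performed in parallel. -/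
theorem Reach.glueAt {n : ℕ} {A B C : ℤ} {f f' g g' : ℤ → V} (hAB : A ≤ B) (hBC : B ≤ C)
    (hf : G.Reach n A B f f') (hg : G.Reach n B C g g') (hB : f B = g B) :
    G.Reach n A C (glueAt B f g) (glueAt B f' g') := by
  induction n generalizing f' g' with
  | zero => cases hf; cases hg; rfl
  | succ n ih =>
    obtain ⟨u, hu, s, hs₁, hs₂⟩ := hf
    obtain ⟨v, hv, t, ht₁, ht₂⟩ := hg
    have h₁ : u B = v B := by
      rw [Reach.supp hu B (by omega), Reach.supp hv B (by omega), hB]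
    have h₂ : s B = t B := by rw [hs₁.supp B (by omega), ht₁.supp B (by omega), h₁]
    exact ⟨_, ih hu hv, _, hs₁.glueAt hAB hBC ht₁ h₁, hs₂.glueAt hAB hBC ht₂ h₂⟩

theorem glueAt_self (B : ℤ) (f : ℤ → V) : LoopGraph.glueAt B f f = f := by
  funext i; simp [LoopGraph.glueAt]

/-! ### Transport of alternating room along a row -/

/-- The segment `[a, B]` of the row is moved to the left by two positions. -/
def shiftLeft (a B : ℤ) (w : ℤ → V) (i : ℤ) : V := if a ≤ i ∧ i + 2 ≤ B then w (i + 2) else w i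

/-- The spine at `a` closes the gap on the left. On the right nothing is required: the last two
letters get repeated, so a spine disappears at `a` and another one appears at `B`, in one step
whatever the length of the segment. -/
theorem lStep_shiftLeft {a B : ℤ} {w : ℤ → V} (hw : G.IsRow w) (ha : w (a + 2) = w a) :
    G.LStep a B w (shiftLeft a B w) := by
  have key : ∀ i, G.Adj (w (i + 2)) (w (i + 1)) := fun i => by
    have := G.symm _ _ (hw (i + 1)); rwa [add_assoc] at this
  refine ⟨fun i => ?_, fun i => ?_, fun i hi => ?_⟩
  · unfold shiftLeft
    split_ifs with h₁ h₂ h₂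
    · convert hw (i + 2) using 2; ring
    · exact key i
    · obtain rfl : a = i + 1 := by omega
      rw [ha]; exact hw i
    · exact hw i
  · unfold shiftLeft
    split_ifs with h₁
    · exact key i
    · exact hw i
  · unfold shiftLeft
    split_ifs with h₁
    · obtain rfl : i = a := by omega
      exact ha
    · rfl

theorem Alt.shiftLeft_left {a B c : ℤ} {w : ℤ → V} (h : Alt w (c + 2) B) (hac : a ≤ c) :
    Alt (shiftLeft a B w) c B := fun i hi₁ hi₂ => by
  unfold shiftLeft
  rw [if_pos (show a ≤ i ∧ i + 2 ≤ B by omega)]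
  split_ifs with h₁
  · exact h (i + 2) (by omega) h₁.2
  · rfl

/-- The room at the left end of `[a, c]` is moved to its right end. -/
theorem exists_reach_move_room {a B : ℤ} (m : ℕ) {w : ℤ → V} {c : ℤ} (hw : G.IsRow w)
    (h₁ : Alt w a (a + 2 * m)) (h₂ : Alt w c B) (hc : a + 2 * m ≤ c) (hcB : c ≤ B) :
    ∃ w', G.Reach m a B w w' ∧ Alt w' (c - 2 * m) B := by
  induction m generalizing w c with
  | zero => exact ⟨w, rfl, by simpa using h₂⟩
  | succ m ih =>
    push_cast at h₁ hc ⊢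
    -- One pair of alternating letters leaves the left end and reappears at `B`; the target segment
    -- moves two positions to the left.
    have hs := lStep_shiftLeft (B := B) hw (h₁ a le_rfl (by omega))
    obtain ⟨w', hr, hA⟩ := ih (c := c - 2) hs.row (fun i hi hi' => by
        unfold shiftLeft
        rw [if_pos ⟨by omega, by omega⟩, if_pos ⟨by omega, by omega⟩]
        exact h₁ _ (by omega) (by omega))
      (Alt.shiftLeft_left (by simpa using h₂) (by omega)) (by omega) (by omega)
    refine ⟨w', ?_, hA.mono (by omega) le_rfl⟩
    rw [add_comm]; exact hs.reach.trans hr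

/-- An alternating segment absorbs the letter at its right and loses the one at its left. -/
theorem exists_lStep_slide {P Q : ℤ} {w : ℤ → V} (hw : G.IsRow w) (h : Alt w P Q) :
    ∃ w', G.LStep P Q w w' ∧ Alt w' (P + 1) (Q + 1) := by
  have key : ∀ i, P ≤ i → i ≤ Q → (Q - i) % 2 = 0 → G.Adj (w i) (w (Q + 1)) := fun i h₁ h₂ h₃ => by
    rw [h.eq_of_even h₁ h₂ h₃]; exact hw Q
  -- Inside the segment, the letters of the parity opposite to `Q` are replaced by `w (Q + 1)`, a
  -- neighbour of `w Q`. The letter at `P` is kept, which is why alternation only starts at `P + 1`.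
  refine ⟨fun i => if P < i ∧ i < Q ∧ (Q - i) % 2 = 1 then w (Q + 1) else w i,
    ⟨fun i => ?_, fun i => ?_, fun i hi => ?_⟩, fun i hi₁ hi₂ => ?_⟩
  · split_ifs with h₁ h₂ h₂
    · omega
    · exact G.symm _ _ (key _ (by omega) (by omega) (by omega))
    · exact key _ (by omega) (by omega) (by omega)
    · exact hw i
  · split_ifs with h₁
    · exact G.symm _ _ (key _ (by omega) (by omega) (by omega))
    · exact hw i
  · exact if_neg (by omega)
  · dsimp only
    split_ifs with h₁ h₂ h₂
    · rfl
    · omega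
    · congr 1; omega
    · exact h i (by omega) (by omega)

theorem exists_reach_slide {P Q : ℤ} (k : ℕ) {w : ℤ → V} (hw : G.IsRow w) (h : Alt w P Q) :
    ∃ w', G.Reach (k + 1) P (Q + k) w w' ∧ Alt w' (P + (k + 1)) (Q + (k + 1)) := by
  induction k with
  | zero =>
    obtain ⟨w', h₁, h₂⟩ := exists_lStep_slide hw h
    exact ⟨w', by simpa using h₁.reach, by simpa using h₂⟩
  | succ k ih =>
    obtain ⟨w', h₁, h₂⟩ := ih
    obtain ⟨w'', h₃, h₄⟩ := exists_lStep_slide (h₁.row hw) h₂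
    refine ⟨w'', (h₁.mono le_rfl ?_).trans (h₃.reach.mono ?_ ?_), h₄.mono ?_ ?_⟩ <;>
      push_cast <;> omega

end LoopGraph

/-! ### Homotopy of walks and square decompositions -/

namespace LoopGraph

variable {V : Type*} {G : LoopGraph V}

/-- Elementary homotopies: a spine is removed, or one letter is replaced by another one. -/
inductive HStep (G : LoopGraph V) : List V → List V → Prop
  | spine (x y : List V) (a b : V) : G.Adj a b → HStep G (x ++ [a, b, a] ++ y) (x ++ [a] ++ y)
  | flip (x y : List V) (a b c d : V) : G.Adj a b → G.Adj b c → G.Adj a d → G.Adj d c →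
      HStep G (x ++ [a, b, c] ++ y) (x ++ [a, d, c] ++ y)

/-- Homotopy of words, relative to the end points. -/
def Htpy (G : LoopGraph V) : List V → List V → Prop := Relation.EqvGen G.HStep

theorem Htpy.refl (p : List V) : G.Htpy p p := Relation.EqvGen.refl p

theorem Htpy.symm {p q : List V} (h : G.Htpy p q) : G.Htpy q p := Relation.EqvGen.symm _ _ h

theorem Htpy.trans {p q r : List V} (h : G.Htpy p q) (h' : G.Htpy q r) : G.Htpy p r :=
  Relation.EqvGen.trans _ _ _ h h'

theorem HStep.htpy {p q : List V} (h : G.HStep p q) : G.Htpy p q := Relation.EqvGen.rel _ _ h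

theorem Htpy.context {p q : List V} (h : G.Htpy p q) (x y : List V) :
    G.Htpy (x ++ p ++ y) (x ++ q ++ y) := by
  induction h with
  | rel p q h =>
    cases h with
    | spine x' y' a b h => simpa using (HStep.spine (x ++ x') (y' ++ y) a b h).htpy
    | flip x' y' a b c d h₁ h₂ h₃ h₄ =>
      simpa using (HStep.flip (x ++ x') (y' ++ y) a b c d h₁ h₂ h₃ h₄).htpy
  | refl => exact .refl _
  | symm _ _ _ ih => exact ih.symm
  | trans _ _ _ _ _ ih ih' => exact ih.trans ih'

theorem Htpy.head?_eq {p q : List V} (h : G.Htpy p q) : p.head? = q.head? := by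
  induction h with
  | rel p q h => cases h with
    | spine x => cases x <;> simp
    | flip x => cases x <;> simp
  | refl => rfl
  | symm _ _ _ ih => exact ih.symm
  | trans _ _ _ _ _ ih ih' => exact ih.trans ih'

/-- This invariant makes closed walks even, and hence excludes phase 1. -/
theorem Htpy.length_mod {p q : List V} (h : G.Htpy p q) : p.length % 2 = q.length % 2 := by
  induction h with
  | rel p q h =>
    cases h with
    | spine => simp only [List.length_append, List.length_cons, List.length_nil]; omega
    | flip => simp only [List.length_append, List.length_cons, List.length_nil]
  | refl => rfl
  | symm _ _ _ ih => exact ih.symm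
  | trans _ _ _ _ _ ih ih' => exact ih.trans ih'

theorem SpineStep.htpy {p q : List V} (h : SpineStep p q) (hp : p.IsChain G.Adj) :
    G.Htpy p q ∧ q.IsChain G.Adj := by
  obtain ⟨x, y, a, b, rfl, rfl⟩ := h
  have hab : G.Adj a b := by
    have := hp.infix (l₁ := [a, b]) ⟨x, a :: y, by simp⟩
    simpa using this
  refine ⟨(HStep.spine x y a b hab).htpy, ?_⟩
  have h₁ : (x ++ [a]).IsChain G.Adj := hp.infix ⟨[], [b, a] ++ y, by simp⟩
  have h₂ : ([a] ++ y).IsChain G.Adj := hp.infix ⟨x ++ [a, b], [], by simp⟩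
  exact h₁.append_overlap h₂ (by simp)

theorem IsReductionOf.htpy {p q : List V} (h : IsReductionOf q p) (hp : p.IsChain G.Adj) :
    G.Htpy p q := by
  obtain ⟨h, -⟩ := h
  suffices G.Htpy p q ∧ q.IsChain G.Adj from this.1
  induction h with
  | refl => exact ⟨.refl _, hp⟩
  | tail _ h ih =>
    obtain ⟨h₁, h₂⟩ := SpineStep.htpy h ih.2
    exact ⟨ih.1.trans h₁, h₂⟩

/-- The square `abcda` is reached through `a`, `aba`, `abcba`, then the second `b` is flipped to
`d`. The two decompositions of `s` expose its end letters, where it is spliced into a walk. -/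
theorem IsSquare.htpy {s : List V} (hs : G.IsSquare s) :
    ∃ a t, s = [a] ++ t ∧ s = t.reverse.tail.reverse.cons a ++ [a] ∧ G.Htpy [a] s := by
  obtain ⟨⟨⟨-, hc⟩, hh⟩, hl, -⟩ := hs
  match s, hl with
  | [a, b, c, d, e], _ =>
    obtain rfl : a = e := by simpa using hh
    simp only [List.isChain_cons_cons, List.isChain_singleton, and_true] at hc
    obtain ⟨h₁, h₂, h₃, h₄⟩ := hc
    have s₁ := (HStep.spine [] [] a b h₁).htpy
    have s₂ := (HStep.spine [a] [a] b c h₂).htpy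
    have s₃ := (HStep.flip [a, b] [] c b a d (G.symm _ _ h₂) (G.symm _ _ h₁) h₃ h₄).htpy
    exact ⟨a, [b, c, d, a], rfl, rfl, (s₂.trans s₁).symm.trans s₃⟩

theorem AddSquare.htpy {p q : List V} (hp : G.IsWalk p) (h : G.AddSquare p q) : G.Htpy p q := by
  obtain ⟨k, s, hs, hk, hks, hq⟩ := h
  obtain ⟨a, t, h₁, h₂, hst⟩ := hs.htpy
  have hpk : p[k] = a := by
    rw [List.getElem?_eq_getElem hk, h₁] at hks; simpa using hks
  have hp' : p = p.take k ++ [a] ++ p.drop (k + 1) := by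
    rw [← hpk]; simp
  have hpc := hp.2
  have hsc := hs.1.1.2
  have hch : (insertAt p k s).IsChain G.Adj := by
    unfold insertAt
    rw [hp'] at hpc
    have c₁ : (p.take k ++ [a]).IsChain G.Adj := hpc.infix ⟨[], p.drop (k + 1), by simp⟩
    have c₂ : ([a] ++ p.drop (k + 1)).IsChain G.Adj := hpc.infix ⟨p.take k, [], by simp⟩
    have c₃ : (p.take k ++ s).IsChain G.Adj := by
      rw [h₁] at hsc ⊢
      rw [← List.append_assoc]
      exact c₁.append_overlap hsc (by simp)
    rw [h₂, ← List.append_assoc] at c₃ ⊢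
    exact c₃.append_overlap c₂ (by simp)
  have := hst.context (p.take k) (p.drop (k + 1))
  rw [← hp'] at this
  exact this.trans (hq.htpy hch)

theorem IsDecomposable.htpy {c : List V} (h : G.IsDecomposable c) : ∃ v, G.Htpy c [v] := by
  obtain ⟨v, h⟩ := h
  refine ⟨v, ?_⟩
  generalize [v] = d at h
  induction h with
  | refl => exact .refl _
  | tail _ h ih =>
    obtain ⟨⟨hb, -⟩, ⟨hc, -⟩, h⟩ := h
    refine ih.trans ?_
    rcases h with h | h
    · exact h.htpy hb
    · exact (h.htpy hc).symm

/-- In a square-decomposable graph, every closed walk is contractible. -/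
theorem SquareDecomposable.htpy_of_isCycle (hsq : G.SquareDecomposable) {p : List V}
    (hp : G.IsCycle p) : ∃ v, p.head? = some v ∧ G.Htpy p [v] := by
  suffices ∃ v, G.Htpy p [v] by
    obtain ⟨v, hv⟩ := this
    exact ⟨v, by simpa using hv.head?_eq, hv⟩
  induction hn : p.length using Nat.strong_induction_on generalizing p with
  | _ n ih =>
    by_cases hs : G.IsSimpleCycle p
    · by_cases hb : NonBacktracking p
      · exact (hsq p hs hb).htpy
      · simp only [NonBacktracking, not_forall, not_not] at hb
        obtain ⟨a, b, x, y, rfl⟩ := hb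
        -- The two ends of a spine carry the same vertex, so by simplicity the spine is the whole
        -- cycle.
        obtain ⟨h₁, h₂⟩ := hs.2 x.length (x.length + 2) (by omega) (by simp) (by simp)
        obtain rfl : x = [] := by simpa using h₁
        obtain rfl : y = [] := by simpa using h₂
        have hab : G.Adj a b := by
          have := hp.1.2
          simp at this
          exact this.1
        exact ⟨a, (HStep.spine [] [] a b hab).htpy⟩
    · have hs' := hs
      simp only [IsSimpleCycle, hp, true_and, not_forall] at hs'
      -- A repetition other than that of the two ends splits the cycle into an inner cycle and an
      -- outer one, both strictly shorter.
      obtain ⟨i, j, hij, hj, he, hne⟩ := hs'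
      obtain ⟨a, ha⟩ : ∃ a, p[j]? = some a := ⟨p[j], by simp [hj]⟩
      have hi : i < p.length := hij.trans hj
      have hai : p[i] = a := by rw [ha] at he; simpa [hi] using he
      have haj : p[j] = a := by simpa [hj] using ha
      set x := p.take i with hx
      set y := p.drop (j + 1) with hy
      set t := (p.drop (i + 1)).take (j - i - 1) with ht
      have hxl : x.length = i := by simp [hx]; omega
      have hyl : y.length = p.length - (j + 1) := by simp [hy]
      have htl : t.length = j - i - 1 := by simp [ht]; omega
      have hdec : p = x ++ ([a] ++ t ++ [a]) ++ y := by
        have e₁ : p = x ++ [a] ++ p.drop (i + 1) := by rw [← hai]; simp [hx]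
        have e₂ : p.drop (i + 1) = t ++ p.drop j := by
          have := (List.take_append_drop (j - i - 1) (p.drop (i + 1))).symm
          rwa [List.drop_drop, show i + 1 + (j - i - 1) = j by omega] at this
        have e₃ : p.drop j = [a] ++ y := by
          rw [List.drop_eq_getElem_cons hj, haj]; rfl
        rw [e₂, e₃] at e₁
        simpa using e₁
      have hpc := hp.1.2
      rw [hdec] at hpc
      have hm : G.IsCycle ([a] ++ t ++ [a]) :=
        ⟨⟨by simp, hpc.infix ⟨x, y, rfl⟩⟩, by rw [List.getLast?_concat]; simp⟩
      have hlen : x.length + t.length + 2 + y.length = p.length := by omega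
      obtain ⟨v, hv⟩ := ih _ (by simp; omega) hm rfl
      obtain rfl : a = v := by simpa using hv.head?_eq
      have hred : G.Htpy p (x ++ [a] ++ y) := by
        have := hv.context x y
        rwa [← hdec] at this
      have c₁ : (x ++ [a]).IsChain G.Adj := hpc.infix ⟨[], t ++ [a] ++ y, by simp⟩
      have c₂ : ([a] ++ y).IsChain G.Adj := hpc.infix ⟨x ++ [a] ++ t, [], by simp⟩
      have hq : G.IsCycle (x ++ [a] ++ y) := by
        refine ⟨⟨by simp, c₁.append_overlap c₂ (by simp)⟩, ?_⟩
        have hh := hp.2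
        rw [← hred.head?_eq, hh]
        obtain ⟨z, hz⟩ : ∃ z, ([a] ++ y).getLast? = some z := ⟨_, List.getLast?_cons⟩
        conv_lhs => rw [hdec, show x ++ ([a] ++ t ++ [a]) ++ y = (x ++ ([a] ++ t)) ++ ([a] ++ y) by
          simp, List.getLast?_append, hz]
        rw [List.append_assoc, List.getLast?_append (l := x) (l' := [a] ++ y), hz]
        rfl
      obtain ⟨v, hv⟩ := ih _ (by simp; omega) hq rfl
      exact ⟨v, hred.trans hv⟩

theorem IsCycle.of_append {p q : List V} {a c : V} (hp : (p ++ [c]).IsChain G.Adj)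
    (hq : ([c] ++ q).IsChain G.Adj) (h : (p ++ [c]).head? = some a)
    (h' : ([c] ++ q).getLast? = some a) : G.IsCycle (p ++ [c] ++ q) := by
  refine ⟨⟨by simp, hp.append_overlap hq (by simp)⟩, ?_⟩
  rw [List.append_assoc, List.getLast?_append, h', ← List.append_assoc, List.head?_append, h]
  rfl

theorem IsChain.reverse_adj {p : List V} (h : p.IsChain G.Adj) : p.reverse.IsChain G.Adj := by
  rw [List.isChain_reverse]
  exact h.imp fun a b => G.symm a b

/-- In a square-decomposable graph, two walks with the same end points are homotopic. -/
theorem SquareDecomposable.htpy (hsq : G.SquareDecomposable) {p q : List V} {a c : V}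
    (hp : p.IsChain G.Adj) (hq : q.IsChain G.Adj) (hpa : p.head? = some a)
    (hqa : q.head? = some a) (hpc : p.getLast? = some c) (hqc : q.getLast? = some c) :
    G.Htpy p q := by
  obtain ⟨p', rfl⟩ : ∃ p', p = p' ++ [c] := by
    obtain ⟨p', h⟩ := List.getLast?_eq_some_iff.mp hpc
    exact ⟨p', h⟩
  obtain ⟨q', rfl⟩ : ∃ q', q = [a] ++ q' := by
    obtain ⟨q', h⟩ := List.head?_eq_some_iff.mp hqa
    exact ⟨q', h⟩
  have hr := IsChain.reverse_adj hq
  obtain ⟨r, hr'⟩ : ∃ r, ([a] ++ q').reverse = [c] ++ r := by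
    have : ([a] ++ q').reverse.head? = some c := by rw [List.head?_reverse, hqc]
    obtain ⟨r, h⟩ := List.head?_eq_some_iff.mp this
    exact ⟨r, h⟩
  have hra : ([c] ++ r).getLast? = some a := by rw [← hr', List.getLast?_reverse, hqa]
  -- `c ⋯ a ⋯ c` is contractible, and so is `a ⋯ c ⋯ a`
  have k₁ : G.IsCycle (q'.reverse ++ [a] ++ q') := by
    refine IsCycle.of_append (a := c) (by simpa using hr) hq ?_ hqc
    have : q'.reverse ++ [a] = ([a] ++ q').reverse := by simp
    rw [this, List.head?_reverse, hqc]
  have k₂ : G.IsCycle (p' ++ [c] ++ r) := IsCycle.of_append hp (hr' ▸ hr) hpa hra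
  obtain ⟨v, hv, h₁⟩ := hsq.htpy_of_isCycle k₁
  obtain ⟨u, hu, h₂⟩ := hsq.htpy_of_isCycle k₂
  have e : q'.reverse ++ [a] = [c] ++ r := by rw [← hr']; simp
  rw [e] at h₁ hv
  obtain rfl : c = v := by simpa using hv
  obtain rfl : a = u := by
    rw [List.append_assoc, ← List.append_assoc, List.head?_append, hpa] at hu
    simpa using hu
  -- The loop formed by the reverse of `q` and then `q` is inserted at the end of `p`; next, `p`
  -- followed by the reverse of `q` is contracted, and `q` remains.
  have g₁ := (h₁.context p' []).symm
  have g₂ := h₂.context [] q'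
  simp only [List.append_nil, List.nil_append, List.append_assoc] at g₁ g₂ ⊢
  exact g₁.trans g₂

end LoopGraph

/-! ### Homotopies realised by deformations of rows -/

namespace LoopGraph

variable {V : Type*} {G : LoopGraph V}

/-- The word `p` is read on the row `w` from position `A` on. -/
def Reads (p : List V) (A : ℤ) (w : ℤ → V) : Prop :=
  ∀ (k : ℕ) (h : k < p.length), w (A + k) = p[k]

theorem Reads.congr {p : List V} {A A' : ℤ} {w w' : ℤ → V} (h : Reads p A w)
    (hw : ∀ k : ℕ, k < p.length → w' (A' + k) = w (A + k)) : Reads p A' w' :=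
  fun k hk => (hw k hk).trans (h k hk)

theorem reads_nil {A : ℤ} {w : ℤ → V} : Reads [] A w := fun k hk => by simp at hk

theorem reads_cons {a : V} {p : List V} {A : ℤ} {w : ℤ → V} :
    Reads (a :: p) A w ↔ w A = a ∧ Reads p (A + 1) w := by
  refine ⟨fun h => ⟨?_, fun k hk => ?_⟩, fun h k hk => ?_⟩
  · have := h 0 (by simp)
    rwa [Nat.cast_zero, add_zero] at this
  · have := h (k + 1) (by simpa using hk)
    push_cast at this
    rwa [show A + 1 + (k : ℤ) = A + (k + 1) by ring]
  · cases k with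
    | zero => simpa using h.1
    | succ k =>
      have := h.2 k (by simpa using hk)
      push_cast
      rwa [show A + ((k : ℤ) + 1) = A + 1 + k by ring]

theorem reads_append {p q : List V} {A : ℤ} {w : ℤ → V} :
    Reads (p ++ q) A w ↔ Reads p A w ∧ Reads q (A + p.length) w := by
  induction p generalizing A with
  | nil => simp [reads_nil]
  | cons a p ih =>
    rw [List.cons_append, reads_cons, reads_cons, ih, and_assoc, List.length_cons]
    push_cast
    rw [show A + ((p.length : ℤ) + 1) = A + 1 + p.length by ring]

/-- With enough alternating room at its right, a row reading `p` can be deformed into a row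
reading `q`, in bounded time. -/
def Deforms (G : LoopGraph V) (p q : List V) : Prop :=
  ∃ r T : ℕ, ∀ (A B : ℤ) (w : ℤ → V), G.IsRow w → Reads p A w → Alt w (A + p.length - 1) B →
    A + r ≤ B → ∃ w', G.Reach T A B w w' ∧ Reads q A w' ∧ Alt w' (A + q.length - 1) B

theorem Deforms.refl (p : List V) : G.Deforms p p :=
  ⟨0, 0, fun _ _ w _ h₁ h₂ _ => ⟨w, rfl, h₁, h₂⟩⟩

theorem Deforms.trans {p q s : List V} (h : G.Deforms p q) (h' : G.Deforms q s) :
    G.Deforms p s := by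
  obtain ⟨r, T, h⟩ := h
  obtain ⟨r', T', h'⟩ := h'
  refine ⟨max r r', T + T', fun A B w hw h₁ h₂ hB => ?_⟩
  push_cast at hB
  obtain ⟨w', e₁, e₂, e₃⟩ := h A B w hw h₁ h₂ (by omega)
  obtain ⟨w'', f₁, f₂, f₃⟩ := h' A B w' (e₁.row hw) e₂ e₃ (by omega)
  exact ⟨w'', e₁.trans f₁, f₂, f₃⟩

theorem deforms_spine (x y : List V) (a b : V) :
    G.Deforms (x ++ [a, b, a] ++ y) (x ++ [a] ++ y) := by
  refine ⟨(x ++ [a, b, a] ++ y).length, 1, fun A B w hw h₁ h₂ hB => ?_⟩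
  simp only [reads_append, reads_cons, List.length_append, List.length_cons, List.length_nil,
    reads_nil] at h₁ h₂ hB ⊢
  push_cast at h₁ h₂ hB ⊢
  obtain ⟨⟨hx, ha, hb, ha', -⟩, hy⟩ := h₁
  have hs := lStep_shiftLeft (a := A + x.length) (B := B) hw (by
    rw [ha, ← ha']; congr 1; ring)
  refine ⟨_, hs.reach.mono (by omega) le_rfl, ⟨⟨?_, ?_, trivial⟩, ?_⟩, ?_⟩
  · exact hx.congr fun k hk => hs.supp _ (by omega)
  · rw [hs.supp _ (by omega), ha]
  · refine hy.congr fun k hk => ?_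
    unfold shiftLeft
    rw [if_pos (by omega)]
    congr 1; ring
  · refine Alt.shiftLeft_left (h₂.mono ?_ le_rfl) ?_ <;> omega

theorem deforms_spine_symm (x y : List V) {a b : V} (hab : G.Adj a b) :
    G.Deforms (x ++ [a] ++ y) (x ++ [a, b, a] ++ y) := by
  refine ⟨(x ++ [a, b, a] ++ y).length, 1, fun A B w hw h₁ h₂ hB => ?_⟩
  simp only [reads_append, reads_cons, List.length_append, List.length_cons, List.length_nil,
    reads_nil] at h₁ h₂ hB ⊢
  push_cast at h₁ h₂ hB ⊢
  obtain ⟨⟨hx, ha, -⟩, hy⟩ := h₁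
  set k : ℤ := A + x.length with hk
  -- The letters after `k` move two positions to the right, hence a right step; the room before `B`
  -- loses two letters.
  set w' : ℤ → V := fun i => if i ≤ k then w i else if i = k + 1 then b else
    if i ≤ B then w (i - 2) else w i with hw'
  have e₁ : ∀ i, i ≤ k → w' i = w i := fun i hi => if_pos hi
  have e₂ : w' (k + 1) = b := by simp [hw']
  have e₃ : ∀ i, k + 2 ≤ i → i ≤ B → w' i = w (i - 2) := fun i h₁ h₂ => by
    simp only [hw']; rw [if_neg (by omega), if_neg (by omega), if_pos h₂]
  -- At `B` itself the displaced letter is `w (B - 2)`, which equals `w B` by alternation: this is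
  -- where room is needed.
  have e₄ : ∀ i, B ≤ i → w' i = w i := fun i hi => by
    rcases hi.eq_or_lt with rfl | hi
    · rw [e₃ _ (by omega) le_rfl, ← h₂ _ (by omega) (by omega)]; congr 1; ring
    · simp only [hw']; rw [if_neg (by omega), if_neg (by omega), if_neg (by omega)]
  have hs : G.RStep k B w w' := by
    refine ⟨fun i => ?_, fun i => ?_, fun i hi => hi.elim (e₁ i) (e₄ i)⟩
    · rcases lt_trichotomy i k with h | rfl | h
      · rw [e₁ _ h.le, e₁ _ (by omega)]; exact hw i
      · rw [e₁ _ le_rfl, e₂, ha]; exact hab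
      · rcases eq_or_lt_of_le (show k + 1 ≤ i by omega) with rfl | h
        · rw [e₂, e₃ _ (by omega) (by omega), show k + 1 + 1 - 2 = k by ring, ha]
          exact G.symm _ _ hab
        · by_cases hB : B ≤ i
          · rw [e₄ _ hB, e₄ _ (by omega)]; exact hw i
          · rw [e₃ _ (by omega) (by omega), e₃ _ (by omega) (by omega)]
            convert hw (i - 2) using 2; ring
    · rcases lt_trichotomy i k with h | rfl | h
      · rw [e₁ _ (by omega)]; exact hw i
      · rw [e₂, ha]; exact hab
      · by_cases hB : B ≤ i
        · rw [e₄ _ (by omega)]; exact hw i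
        · rw [e₃ _ (by omega) (by omega)]
          have := G.symm _ _ (hw (i - 1))
          convert this using 2 <;> ring
  refine ⟨w', (hs.reach hw).mono (by omega) le_rfl, ⟨⟨?_, ?_, ?_, ?_, trivial⟩, ?_⟩, ?_⟩
  · exact hx.congr fun k hk => hs.supp _ (by omega)
  · rw [e₁ _ le_rfl, ha]
  · exact e₂
  · rw [e₃ _ (by omega) (by omega), ← ha]; congr 1; ring
  · refine hy.congr fun j hj => ?_
    rw [e₃ _ (by omega) (by omega)]; congr 1; ring
  · intro i hi₁ hi₂
    rw [e₃ _ (by omega) (by omega), e₃ _ (by omega) (by omega),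
      ← h₂ (i - 2) (by omega) (by omega)]
    congr 1; ring

theorem deforms_flip (x y : List V) {a b c d : V} (had : G.Adj a d) (hdc : G.Adj d c) :
    G.Deforms (x ++ [a, b, c] ++ y) (x ++ [a, d, c] ++ y) := by
  refine ⟨(x ++ [a, b, c] ++ y).length, 1, fun A B w hw h₁ h₂ hB => ?_⟩
  simp only [reads_append, reads_cons, List.length_append, List.length_cons, List.length_nil,
    reads_nil] at h₁ h₂ hB ⊢
  push_cast at h₁ h₂ hB ⊢
  obtain ⟨⟨hx, ha, hb, hc, -⟩, hy⟩ := h₁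
  set k : ℤ := A + x.length with hk
  have e : ∀ i, i ≠ k + 1 → Function.update w (k + 1) d i = w i := fun i hi =>
    Function.update_of_ne hi _ _
  have hs : G.LStep k (k + 2) w (Function.update w (k + 1) d) := by
    refine ⟨fun i => ?_, fun i => ?_, fun i hi => e i (by omega)⟩
    · by_cases h₁ : i = k + 1
      · subst h₁
        rw [Function.update_self, e _ (by omega), hc]; exact hdc
      · by_cases h₂ : i = k
        · subst h₂
          rw [e _ h₁, Function.update_self, ha]; exact had
        · rw [e _ h₁, e _ (by omega)]; exact hw i
    · by_cases h₁ : i = k + 1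
      · subst h₁
        rw [Function.update_self, hc]; exact hdc
      · rw [e _ h₁]; exact hw i
  refine ⟨_, hs.reach.mono (by omega) (by omega), ⟨⟨?_, ?_, ?_, ?_, trivial⟩, ?_⟩, ?_⟩
  · exact hx.congr fun k hk => e _ (by omega)
  · rw [e _ (by omega), ha]
  · simp
  · rw [e _ (by omega), hc]
  · exact hy.congr fun k hk => e _ (by omega)
  · exact h₂.congr fun i h _ => e _ (by omega)

/-- Both directions are carried through the induction because homotopy is a symmetric closure,
whereas `Deforms` is not visibly symmetric. -/
theorem Htpy.deforms {p q : List V} (h : G.Htpy p q) : G.Deforms p q ∧ G.Deforms q p := by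
  induction h with
  | rel p q h =>
    cases h with
    | spine x y a b h => exact ⟨deforms_spine x y a b, deforms_spine_symm x y h⟩
    | flip x y a b c d h₁ h₂ h₃ h₄ => exact ⟨deforms_flip x y h₃ h₄, deforms_flip x y h₁ h₂⟩
  | refl => exact ⟨.refl _, .refl _⟩
  | symm _ _ _ ih => exact ih.symm
  | trans _ _ _ _ _ ih ih' => exact ⟨ih.1.trans ih'.1, ih'.2.trans ih.2⟩

/-! ### Compression of walks of fixed length -/

/-- The `L + 1` letters of the row `w` from position `A` on. -/
def segment (w : ℤ → V) (A : ℤ) (L : ℕ) : List V := (List.range (L + 1)).map fun k : ℕ => w (A + k)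

theorem segment_length (w : ℤ → V) (A : ℤ) (L : ℕ) : (segment w A L).length = L + 1 := by
  simp [segment]

theorem reads_segment (w : ℤ → V) (A : ℤ) (L : ℕ) : Reads (segment w A L) A w := fun k hk => by
  simp [segment]

theorem segment_isChain {w : ℤ → V} {A : ℤ} {L : ℕ}
    (h : ∀ k : ℕ, k < L → G.Adj (w (A + k)) (w (A + k + 1))) : (segment w A L).IsChain G.Adj := by
  rw [List.isChain_iff_getElem]
  intro k hk
  rw [segment_length] at hk
  have := h k (by omega)
  simpa [segment, add_assoc] using this

theorem segment_head? (w : ℤ → V) (A : ℤ) (L : ℕ) : (segment w A L).head? = some (w A) := by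
  rw [List.head?_eq_getElem?, List.getElem?_eq_getElem (by simp [segment])]
  simp [segment]

theorem segment_getLast? (w : ℤ → V) (A : ℤ) (L : ℕ) :
    (segment w A L).getLast? = some (w (A + L)) := by
  rw [List.getLast?_eq_getElem?, List.getElem?_eq_getElem (by simp [segment])]
  simp [segment]

/-- The vertices of a finite connected graph are joined by walks of bounded length. -/
theorem Connected.exists_walk [Finite V] (hconn : G.Connected) :
    ∃ D : ℕ, ∀ a c : V, ∃ m ≤ D, ∃ q : ℤ → V, q 0 = a ∧ q m = c ∧
      ∀ k : ℕ, k < m → G.Adj (q k) (q (k + 1)) := by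
  have h : ∀ a c : V, ∃ m : ℕ, ∃ q : ℤ → V, q 0 = a ∧ q m = c ∧
      ∀ k : ℕ, k < m → G.Adj (q k) (q (k + 1)) := fun a c => by
    induction hconn.2 a c with
    | refl => exact ⟨0, fun _ => a, rfl, rfl, by simp⟩
    | @tail b c _ hbc ih =>
      obtain ⟨m, q, h0, hm, hq⟩ := ih
      refine ⟨m + 1, fun i => if i ≤ m then q i else c, by simpa using h0, by simp, fun k hk => ?_⟩
      dsimp only
      rcases Nat.lt_succ_iff_lt_or_eq.mp hk with h | rfl
      · rw [if_pos (by omega), if_pos (by omega)]; exact hq k h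
      · rw [if_pos le_rfl, if_neg (by omega), hm]; exact hbc
  choose m q h0 hm hq using h
  obtain ⟨D, hD⟩ := (Set.finite_range fun x : V × V => m x.1 x.2).bddAbove
  exact ⟨D, fun a c => ⟨m a c, hD ⟨(a, c), rfl⟩, q a c, h0 a c, hm a c, hq a c⟩⟩

/-- With enough alternating room at its right, a walk of bounded length can be deformed in bounded
time into a walk that alternates after `D` letters, where `D` is independent of the length. -/
theorem SquareDecomposable.exists_compress [Finite V] (hsq : G.SquareDecomposable) {D : ℕ}
    (hD : ∀ a c : V, ∃ m ≤ D, ∃ q : ℤ → V, q 0 = a ∧ q m = c ∧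
      ∀ k : ℕ, k < m → G.Adj (q k) (q (k + 1))) (L : ℕ) :
    ∃ r T : ℕ, ∀ (A B : ℤ) (w : ℤ → V), G.IsRow w → Alt w (A + L) B → A + r ≤ B →
      ∃ w', G.Reach T A B w w' ∧ Alt w' (A + D) B := by
  have h : ∀ f : Fin (L + 1) → V, ∃ r T : ℕ, ∀ (A B : ℤ) (w : ℤ → V), G.IsRow w →
      (∀ k : Fin (L + 1), w (A + (k : ℕ)) = f k) → Alt w (A + L) B → A + r ≤ B →
      ∃ w', G.Reach T A B w w' ∧ Alt w' (A + D) B := fun f => by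
    -- The target walk is chosen from one row that reads `f`, and serves for all of them; if there
    -- is none, the claim is vacuous.
    by_cases hf : ∃ (A : ℤ) (w : ℤ → V), G.IsRow w ∧ ∀ k : Fin (L + 1), w (A + (k : ℕ)) = f k
    · obtain ⟨A₀, w₀, hw₀, hf₀⟩ := hf
      obtain ⟨m, hm, q, hq0, hqm, hq⟩ := hD (w₀ A₀) (w₀ (A₀ + L))
      obtain ⟨r, T, hrT⟩ := (hsq.htpy (segment_isChain fun k _ => hw₀ (A₀ + k))
        (segment_isChain (A := 0) (w := q) (L := m) (by simpa using hq)) (segment_head? _ _ _)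
        (by rw [segment_head?, hq0]) (segment_getLast? w₀ A₀ L)
        (by rw [segment_getLast?, zero_add, hqm])).deforms.1
      refine ⟨r, T, fun A B w hw hwf hA hB => ?_⟩
      obtain ⟨w', h₁, -, h₂⟩ := hrT A B w hw ((reads_segment w₀ A₀ L).congr fun k hk => by
          rw [segment_length] at hk
          exact (hwf ⟨k, hk⟩).trans (hf₀ ⟨k, hk⟩).symm)
        (hA.mono (by rw [segment_length]; push_cast; omega) le_rfl) hB
      exact ⟨w', h₁, h₂.mono (by rw [segment_length]; push_cast; omega) le_rfl⟩
    · exact ⟨0, 0, fun A B w hw hwf => (hf ⟨A, w, hw, hwf⟩).elim⟩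
  choose r T hrT using h
  -- There are finitely many words of `L + 1` letters, so the rooms and times are bounded uniformly.
  obtain ⟨R, hR⟩ := (Set.finite_range r).bddAbove
  obtain ⟨S, hS⟩ := (Set.finite_range T).bddAbove
  refine ⟨R, S, fun A B w hw hA hB => ?_⟩
  have h₁ := hR ⟨fun k : Fin (L + 1) => w (A + (k : ℕ)), rfl⟩
  have h₂ := hS ⟨fun k : Fin (L + 1) => w (A + (k : ℕ)), rfl⟩
  obtain ⟨w', e₁, e₂⟩ := hrT (fun k : Fin (L + 1) => w (A + (k : ℕ))) A B w hw (fun _ => rfl) hA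
    (by omega)
  exact ⟨w', e₁.le hw h₂, e₂⟩

end LoopGraph

/-! ### Contraction of long walks in logarithmic time -/

namespace LoopGraph

variable {V : Type*} {G : LoopGraph V}

/-- If walks of length `D + 2` can be compressed to length `D` within a room of size `2 * ρ`, then
a room of this size can be enlarged by any fixed amount in bounded time. -/
theorem exists_enlarge {D ρ T₀ : ℕ}
    (hF : ∀ (A B : ℤ) (w : ℤ → V), G.IsRow w → Alt w (A + (D + 2 : ℕ)) B →
      A + D + 2 * ρ ≤ B → ∃ w', G.Reach T₀ A B w w' ∧ Alt w' (A + D) B) (s : ℕ) :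
    ∃ T : ℕ, ∀ (A : ℤ) (w : ℤ → V), G.IsRow w → Alt w (A + D) (A + D + 2 * ρ) →
      ∃ w', G.Reach T A (A + D + 2 * ρ + 2 * s) w w' ∧
        Alt w' (A + D) (A + D + 2 * ρ + 2 * s) := by
  induction s with
  | zero => exact ⟨0, fun A w _ h => ⟨w, rfl, by simpa using h⟩⟩
  | succ s ih =>
    obtain ⟨T, ih⟩ := ih
    refine ⟨T + ((ρ + s) + T₀), fun A w hw h => ?_⟩
    obtain ⟨w₁, h₁, a₁⟩ := ih A w hw h
    have r₁ := h₁.row hw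
    push_cast
    -- The room jumps over the two letters at its right, which leaves `D + 2` letters followed by
    -- room; compressing them to `D` gains two positions.
    obtain ⟨w₂, h₂, a₂⟩ := exists_reach_move_room (a := A + D) (c := A + D + 2 * ρ + 2 * (s + 1))
      (B := A + D + 2 * ρ + 2 * (s + 1)) (ρ + s) r₁ (a₁.mono le_rfl (by push_cast; omega))
      (Alt.of_short (by omega)) (by push_cast; omega) le_rfl
    obtain ⟨w₃, h₃, a₃⟩ := hF A (A + D + 2 * ρ + 2 * (s + 1)) w₂ (h₂.row r₁)
      (a₂.mono (by push_cast; omega) le_rfl) (by omega)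
    exact ⟨w₃, (h₁.mono le_rfl (by omega)).trans ((h₂.mono (by omega) le_rfl).trans h₃), a₃⟩

/-- A walk of length of order `2 ^ j` can be compressed to bounded length in `O(j)` steps. -/
theorem SquareDecomposable.exists_contract [Finite V] (hconn : G.Connected)
    (hsq : G.SquareDecomposable) :
    ∃ D r C : ℕ, 0 < D ∧ ∀ (j : ℕ) (A : ℤ) (w : ℤ → V), G.IsRow w →
      Alt w (A + D) (A + D + r) →
      ∃ w', G.Reach (C * j) A (A + D + r + (2 ^ j - 1) * (D + r)) w w' ∧
        Alt w' (A + D) (A + D + r + (2 ^ j - 1) * (D + r)) := by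
  obtain ⟨D₀, hD₀⟩ := hconn.exists_walk
  -- The bound `D = 2 * δ` is even because room travels by pairs of letters, and positive so that
  -- the contracted lengths grow like `2 ^ j`.
  obtain ⟨δ, hδ⟩ : ∃ δ : ℕ, δ = D₀ + 1 := ⟨_, rfl⟩
  have hD : ∀ a c : V, ∃ m ≤ 2 * δ, ∃ q : ℤ → V, q 0 = a ∧ q m = c ∧
      ∀ k : ℕ, k < m → G.Adj (q k) (q (k + 1)) := fun a c => by
    obtain ⟨m, hm, h⟩ := hD₀ a c
    exact ⟨m, by omega, h⟩
  obtain ⟨r₂, T₂, h₂⟩ := hsq.exists_compress hD (2 * δ + 2)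
  obtain ⟨r₃, T₃, h₃⟩ := hsq.exists_compress hD (2 * (2 * δ) + 1)
  obtain ⟨ρ, hρ⟩ : ∃ ρ : ℕ, ρ = r₂ + r₃ := ⟨_, rfl⟩
  obtain ⟨Tg, hg⟩ := exists_enlarge (G := G) (D := 2 * δ) (ρ := ρ) (T₀ := T₂)
    (fun A B w hw hA hB => h₂ A B w hw hA (by push_cast at hB; omega)) (δ + ρ)
  refine ⟨2 * δ, 2 * ρ, Tg + ((δ + ρ) + (2 * δ + 1 + T₃)), by omega, fun j => ?_⟩
  push_cast at hg h₃ ⊢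
  induction j with
  | zero => exact fun A w hw h => ⟨w, rfl, by simpa using h⟩
  | succ j ih =>
    intro A w hw hA
    obtain ⟨l, hl⟩ : ∃ l : ℤ, l = (2 ^ j - 1) * (2 * δ + 2 * ρ) := ⟨_, rfl⟩
    have hl0 : 0 ≤ l := by
      rw [hl]
      have : (1 : ℤ) ≤ 2 ^ j := one_le_pow₀ (by norm_num)
      exact mul_nonneg (by omega) (by positivity)
    have hl' : ((2 : ℤ) ^ (j + 1) - 1) * (2 * δ + 2 * ρ) = 2 * l + (2 * δ + 2 * ρ) := by
      rw [hl]; ring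
    rw [← hl] at ih
    rw [hl']
    obtain ⟨B, hB⟩ : ∃ B : ℤ, B = A + 2 * δ + 2 * ρ + (2 * l + (2 * δ + 2 * ρ)) := ⟨_, rfl⟩
    -- The midpoint: `[A, M]` and `[M, B]` both have the length handled at stage `j`.
    obtain ⟨M, hM⟩ : ∃ M : ℤ, M = A + 2 * δ + 2 * ρ + l := ⟨_, rfl⟩
    rw [← hB]
    obtain ⟨w₁, e₁, a₁⟩ := hg A w hw hA
    have k₁ := e₁.row hw
    -- The enlarged room has size `r + (D + r)`. Its first `r` positions stay for the left half; the
    -- rest is carried to `[M, M + D + r]` for the right half.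
    obtain ⟨w₂, e₂, a₂⟩ := exists_reach_move_room (a := A + 2 * δ + 2 * ρ)
      (c := M + (2 * δ + 2 * ρ)) (B := M + (2 * δ + 2 * ρ)) (δ + ρ) k₁
      (a₁.mono (by omega) (by push_cast; omega)) (Alt.of_short (by omega)) (by push_cast; omega)
      le_rfl
    have k₂ := e₂.row k₁
    push_cast at a₂
    obtain ⟨f, ef, af⟩ := ih A w₂ k₂ ((a₁.mono le_rfl (by omega)).congr
      fun i _ hi => e₂.supp i (by omega))
    obtain ⟨g, eg, ag⟩ := ih M w₂ k₂ (a₂.mono (by omega) (by omega))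
    rw [← hM] at ef af
    rw [show M + 2 * δ + 2 * ρ + l = B by omega] at eg ag
    have hfg : f M = g M := by rw [ef.supp M (by omega), eg.supp M (by omega)]
    have e₃ := ef.glueAt (by omega) (by omega) eg rfl
    rw [glueAt_self] at e₃
    have k₃ := e₃.row k₂
    have a₃ : Alt (LoopGraph.glueAt M f g) (A + 2 * δ) M :=
      af.congr fun i _ hi => glueAt_left hi
    have a₃' : Alt (LoopGraph.glueAt M f g) (M + 2 * δ) B :=
      ag.congr fun i hi _ => glueAt_right hfg (by omega)
    -- The left alternation slides over the `D` letters after `M`, and one more, so as to overlap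
    -- the right alternation in two positions; the two then merge. There remain `2 * D + 1` letters
    -- to compress.
    obtain ⟨w₄, e₄, a₄⟩ := exists_reach_slide (2 * δ) k₃ a₃
    push_cast at e₄ a₄
    obtain ⟨w₅, e₅, a₅⟩ := h₃ A B w₄ (e₄.row k₃) ((a₄.join
      (a₃'.congr fun i hi _ => e₄.supp i (by omega)) (by omega)).mono (by omega) le_rfl) (by omega)
    refine ⟨w₅, ?_, a₅⟩
    have := (e₁.mono le_rfl (by omega)).trans ((e₂.mono (by omega) (by omega)).trans
      (e₃.trans ((e₄.mono (by omega) (by omega)).trans e₅)))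
    convert this using 1
    ring

end LoopGraph

/-! ### From rows with alternating tails to successive rows joining them -/

theorem IterRel.map {α β : Type*} {R : α → α → Prop} {S : β → β → Prop} (f : α → β)
    (hf : ∀ a b, R a b → S (f a) (f b)) {n : ℕ} {a b : α} (h : IterRel R n a b) :
    IterRel S n (f a) (f b) := by
  induction n generalizing b with
  | zero => exact congrArg f h
  | succ n ih =>
    obtain ⟨d, hd, hdb⟩ := h
    exact ⟨_, ih hd, hf _ _ hdb⟩

namespace LoopGraph

variable {V : Type*} {G : LoopGraph V}

/-- `w` and `w'` can be successive rows of a configuration. -/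
def RowAdj (G : LoopGraph V) (w w' : ℤ → V) : Prop :=
  G.IsRow w ∧ G.IsRow w' ∧ ∀ i, G.Adj (w i) (w' i)

theorem RowAdj.symm {w w' : ℤ → V} (h : G.RowAdj w w') : G.RowAdj w' w :=
  ⟨h.2.1, h.1, fun i => G.symm _ _ (h.2.2 i)⟩

theorem IsRow.shift {w : ℤ → V} (h : G.IsRow w) (e : ℤ) : G.IsRow fun i => w (i - e) := fun i => by
  have := h (i - e)
  rwa [show i - e + 1 = i + 1 - e by ring] at this

theorem RowAdj.shift {w w' : ℤ → V} (h : G.RowAdj w w') (e : ℤ) :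
    G.RowAdj (fun i => w (i - e)) fun i => w' (i - e) :=
  ⟨h.1.shift e, h.2.1.shift e, fun _ => h.2.2 _⟩

theorem Step.rowAdj {A B : ℤ} {w w' : ℤ → V} (hw : G.IsRow w) (h : G.Step A B w w') :
    IterRel G.RowAdj 4 w w' := by
  obtain ⟨v, h₁, h₂⟩ := h
  -- The successive rows are `w`, its left shift, `v`, the right shift of `v`, and `w'`.
  refine ⟨fun i => v (i - 1), ⟨v, ⟨fun i => w (i + 1), ⟨w, rfl, hw, fun _ => hw _, hw⟩,
    fun i => hw _, h₁.row, fun i => G.symm _ _ (h₁.diag i)⟩, h₁.row, h₁.row.shift 1, fun i => ?_⟩,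
    h₁.row.shift 1, h₂.row, fun i => ?_⟩
  · have := h₁.row (i - 1)
    rw [sub_add_cancel] at this
    exact G.symm _ _ this
  · have := h₂.diag (i - 1)
    rwa [sub_add_cancel] at this

theorem Reach.rowAdj {n : ℕ} {A B : ℤ} {w w' : ℤ → V} (hw : G.IsRow w) (h : G.Reach n A B w w') :
    IterRel G.RowAdj (4 * n) w w' :=
  (IterRel.mul (P := G.IsRow) (fun _ _ _ ⟨_, _, h⟩ => h.row) (fun _ _ => Step.rowAdj) hw h).2

/-- The row alternates between two letters. -/
def Alternating (w : ℤ → V) : Prop := ∀ i, w (i + 2) = w i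

theorem Alternating.eq {w : ℤ → V} (h : Alternating w) {i j : ℤ} (hij : (i - j) % 2 = 0) :
    w i = w j := by
  have h' : ∀ a b, Alt w a b := fun a b i _ _ => h i
  rcases le_total i j with hl | hl
  · exact (h' i j).eq_of_even le_rfl hl (by omega)
  · exact ((h' j i).eq_of_even le_rfl hl (by omega)).symm

/-- A row that alternates to the left of `a` and to the right of `a + k` is pushed to the left
until it alternates everywhere. -/
theorem exists_alternating_of_tails {a : ℤ} {k : ℕ} {w : ℤ → V} (hw : G.IsRow w)
    (hl : ∀ i, i + 2 ≤ a → w (i + 2) = w i) (hr : ∀ i, a + k ≤ i → w (i + 2) = w i) :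
    ∃ y, IterRel G.RowAdj (k + 1) w y ∧ Alternating y := by
  -- To the right of `a` the row moves left by one letter at each step; the left tail alternates
  -- between the two letters that reached or crossed `a` last.
  let F : ℕ → ℤ → V := fun s i =>
    if a ≤ i then w (i + s) else if (a - i) % 2 = 0 then w (a + s) else w (a + s - 1)
  have hadj : ∀ i j, j = i + 1 → G.Adj (w i) (w j) := fun i j h => h ▸ hw i
  have hadj' : ∀ i j, i = j + 1 → G.Adj (w i) (w j) := fun i j h => h ▸ G.symm _ _ (hw j)
  have hF : ∀ s, G.IsRow (F s) := fun s i => by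
    simp only [F]
    split_ifs
    all_goals first
      | omega
      | exact hadj _ _ (by omega)
      | exact hadj' _ _ (by omega)
  have hF0 : F 0 = w := by
    funext i
    have h : ∀ b, b ≤ a → Alt w i b := fun b hb i _ _ => hl i (by omega)
    simp only [F, Nat.cast_zero, add_zero]
    split_ifs with h₁ h₂
    · rfl
    · exact ((h a le_rfl).eq_of_even le_rfl (by omega) h₂).symm
    · exact ((h (a - 1) (by omega)).eq_of_even le_rfl (by omega) (by omega)).symm
  -- After `k + 1` steps both `w (a + s)` and `w (a + s - 1)` belong to the right tail.
  refine ⟨F (k + 1), ?_, fun i => ?_⟩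
  · have := IterRel.of_seq (R := G.RowAdj) (n := k + 1) F fun s _ => ⟨hF s, hF _, fun i => by
      simp only [F]
      push_cast
      split_ifs <;> exact hadj _ _ (by ring)⟩
    rwa [hF0] at this
  · have hr' : ∀ i j, a + k ≤ i → j = i + 2 → w j = w i := fun i j h e => e ▸ hr i h
    simp only [F]
    push_cast
    split_ifs
    all_goals first
      | omega
      | rfl
      | exact hr' _ _ (by omega) (by omega)
      | (congr 1; omega)

/-- A row that alternates outside an interval of length less than `2 ^ j` is joined to an
alternating row in `O(j)` steps. -/
theorem SquareDecomposable.exists_alternating [Finite V] (hconn : G.Connected)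
    (hsq : G.SquareDecomposable) :
    ∃ c₁ c₂ : ℕ, ∀ (j : ℕ) (a b : ℤ) (w : ℤ → V), G.IsRow w →
      (∀ i, i + 2 ≤ a → w (i + 2) = w i) → (∀ i, b ≤ i → w (i + 2) = w i) → b - a < 2 ^ j →
      ∃ y, IterRel G.RowAdj (c₁ * j + c₂) w y ∧ Alternating y := by
  obtain ⟨D, r, C, hD, h⟩ := hsq.exists_contract hconn
  refine ⟨4 * C, 4 + (D + 1 + 1), fun j a b w hw hl hr hj => ?_⟩
  -- With this choice the initial room `[A + D, A + D + r]` is `[a - r, a]`, inside the left tail.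
  obtain ⟨A, hA⟩ : ∃ A : ℤ, A = a - D - r := ⟨_, rfl⟩
  obtain ⟨B, hB⟩ : ∃ B : ℤ, B = A + D + r + (2 ^ j - 1) * (D + r) := ⟨_, rfl⟩
  have hpos : (0 : ℤ) ≤ 2 ^ j - 1 := by
    have : (1 : ℤ) ≤ 2 ^ j := one_le_pow₀ (by norm_num)
    omega
  have hbB : b ≤ B := by
    have : (2 ^ j - 1 : ℤ) * 1 ≤ (2 ^ j - 1) * (D + r) :=
      mul_le_mul_of_nonneg_left (by omega) hpos
    omega
  have hAB : A + D + r ≤ B := by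
    have : (0 : ℤ) ≤ (2 ^ j - 1) * (D + r) := mul_nonneg hpos (by omega)
    omega
  obtain ⟨w₁, e₁, a₁⟩ := h j A w hw fun i _ hi => hl i (by omega)
  rw [← hB] at e₁ a₁
  have k₁ := e₁.row hw
  -- One slide makes the alternation overlap the right tail in the two positions `B` and `B + 1`.
  obtain ⟨w₂, e₂, a₂⟩ := exists_lStep_slide k₁ a₁
  have hs : ∀ i, i ≤ A ∨ B ≤ i → w₂ i = w i := fun i hi => by
    rw [e₂.supp i (by omega), e₁.supp i hi]
  obtain ⟨y, hy, hy'⟩ := exists_alternating_of_tails (a := A) (k := D + 1) e₂.row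
    (fun i hi => by rw [hs _ (by omega), hs _ (by omega), hl i (by omega)])
    (fun i hi => by
      push_cast at hi
      by_cases hiB : B ≤ i
      · rw [hs _ (by omega), hs _ (by omega), hr i (by omega)]
      · exact a₂ i (by omega) (by omega))
  refine ⟨y, ?_, hy'⟩
  have := ((e₁.rowAdj hw).trans (e₂.reach.rowAdj k₁)).trans hy
  convert this using 1
  ring

/-- Two alternating rows are joined, up to a shift by `0` or `1`, by any large enough number of
steps. -/
theorem Connected.exists_rowAdj_alternating [Finite V] (hconn : G.Connected) :
    ∃ D : ℕ, ∀ (H : ℕ) (y y' : ℤ → V), G.IsRow y → G.IsRow y' → Alternating y →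
      Alternating y' → D < H →
      ∃ e : ℤ, (e = 0 ∨ e = 1) ∧ IterRel G.RowAdj H y fun i => y' (i - e) := by
  obtain ⟨D, hD⟩ := hconn.exists_walk
  refine ⟨D, fun H y y' hy hy' ha ha' hH => ?_⟩
  obtain ⟨m, hm, q, hq0, hqm, hq⟩ := hD (y 0) (y' 0)
  -- One bi-infinite walk runs along `y`, then a path to `y' 0`, then `y'`. The row at time `s`
  -- alternates between `p s` and `p (s - 1)`.
  let p : ℤ → V := fun t => if t < 0 then y t else if t ≤ m then q t else y' (t - m)
  have hp0 : ∀ t, t ≤ 0 → p t = y t := fun t ht => by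
    rcases ht.eq_or_lt with rfl | ht
    · simp [p, hq0]
    · simp [p, ht]
  have hpm : ∀ t, (m : ℤ) ≤ t → p t = y' (t - m) := fun t ht => by
    rcases ht.eq_or_lt with rfl | ht
    · simp [p, hqm]
    · simp only [p]; rw [if_neg (by omega), if_neg (by omega)]
  have hp : G.IsRow p := fun t => by
    by_cases h₁ : t < 0
    · rw [hp0 _ h₁.le, hp0 _ (by omega)]; exact hy t
    by_cases h₂ : (m : ℤ) ≤ t
    · rw [hpm _ h₂, hpm _ (by omega), show t + 1 - m = t - m + 1 by ring]; exact hy' _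
    simp only [p]
    rw [if_neg h₁, if_pos (show t ≤ m by omega), if_neg (show ¬ t + 1 < 0 by omega),
      if_pos (show t + 1 ≤ m by omega)]
    have := hq t.toNat (by omega)
    rwa [Int.toNat_of_nonneg (by omega)] at this
  let F : ℕ → ℤ → V := fun s i => if i % 2 = 0 then p s else p (s - 1)
  have hp' : ∀ s : ℤ, G.Adj (p (s - 1)) (p s) := fun s => by
    have := hp (s - 1); rwa [sub_add_cancel] at this
  have hF : ∀ s, G.IsRow (F s) := fun s i => by
    simp only [F]
    split_ifs
    · omega
    · exact G.symm _ _ (hp' s)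
    · exact hp' s
    · omega
  have key := IterRel.of_seq (R := G.RowAdj) (n := H) F fun s _ => ⟨hF s, hF _, fun i => by
    simp only [F]
    push_cast
    split_ifs
    · exact hp s
    · rw [add_sub_cancel_right]; exact hp' s⟩
  have h0 : F 0 = y := by
    funext i
    simp only [F, Nat.cast_zero]
    split_ifs
    · rw [hp0 _ le_rfl]; exact ha.eq (by omega)
    · rw [hp0 _ (by omega)]; exact ha.eq (by omega)
  -- Since `H > m`, the last row only uses letters of `y'`; the parity of `H - m` decides the shift.
  have h1 : F H = fun i => y' (i - ((H : ℤ) - m) % 2) := by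
    funext i
    simp only [F]
    split_ifs
    · rw [hpm _ (by omega)]; exact ha'.eq (by omega)
    · rw [hpm _ (by omega)]; exact ha'.eq (by omega)
  rw [h0, h1] at key
  exact ⟨_, by omega, key⟩

theorem SquareDecomposable.exists_rowAdj [Finite V] (hconn : G.Connected)
    (hsq : G.SquareDecomposable) :
    ∃ c₁ c₂ : ℕ, ∀ (j n H : ℕ) (a a' : ℤ) (w w' : ℤ → V), n < 2 ^ j → c₁ * j + c₂ ≤ H →
      G.IsRow w → (∀ i, i + 2 ≤ a → w (i + 2) = w i) → (∀ i, a + n ≤ i → w (i + 2) = w i) →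
      G.IsRow w' → (∀ i, i + 2 ≤ a' → w' (i + 2) = w' i) →
      (∀ i, a' + n ≤ i → w' (i + 2) = w' i) →
      ∃ e : ℤ, (e = 0 ∨ e = 1) ∧ IterRel G.RowAdj H w fun i => w' (i - e) := by
  obtain ⟨c₁, c₂, hc⟩ := hsq.exists_alternating hconn
  obtain ⟨D, hD⟩ := hconn.exists_rowAdj_alternating
  refine ⟨2 * c₁, 2 * c₂ + D + 1, fun j n H a a' w w' hn hH hw hl hr hw' hl' hr' => ?_⟩
  have hn' : (n : ℤ) < 2 ^ j := by exact_mod_cast hn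
  obtain ⟨y, h₁, hy⟩ := hc j a (a + n) w hw hl hr (by omega)
  obtain ⟨y', h₁', hy'⟩ := hc j a' (a' + n) w' hw' hl' hr' (by omega)
  have row : ∀ {N : ℕ} {u v : ℤ → V}, G.IsRow u → IterRel G.RowAdj N u v → G.IsRow v :=
    fun {N u v} hu h => by
      cases N with
      | zero => cases h; exact hu
      | succ N => obtain ⟨_, _, h⟩ := h; exact h.2.1
  obtain ⟨k, hk⟩ : ∃ k, k = c₁ * j + c₂ := ⟨_, rfl⟩
  have hkH : 2 * k + D + 1 ≤ H := by rw [hk]; linarith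
  obtain ⟨e, he, h₂⟩ := hD (H - 2 * k) y y' (row hw h₁) (row hw' h₁') hy hy' (by omega)
  refine ⟨e, he, ?_⟩
  -- The path from `w'` to `y'` is shifted by `e` and traversed backwards.
  have h₃ := (IterRel.map (S := G.RowAdj) (fun (v : ℤ → V) i => v (i - e))
    (fun _ _ h => h.shift e) h₁').symm fun _ _ => RowAdj.symm
  rw [← hk] at h₁ h₃
  have := (h₁.trans h₂).trans h₃
  rwa [show k + (H - 2 * k) + k = H by omega] at this

end LoopGraph

/-! ### Extension of blocks and gluing of configurations -/

namespace LoopGraph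

variable {V : Type*} {G : LoopGraph V}

theorem mem_homShift {x : ℤ × ℤ → V} :
    x ∈ G.homShift ↔ (∀ k, G.IsRow fun i => x (i, k)) ∧ ∀ i, G.IsRow fun k => x (i, k) := by
  refine ⟨fun h => ⟨fun k i => h _ _ (by simp), fun i k => h _ _ (by simp)⟩, ?_⟩
  rintro ⟨h₁, h₂⟩ ⟨a, b⟩ ⟨c, d⟩ h
  have h' : (b = d ∧ (c = a + 1 ∨ a = c + 1)) ∨ (a = c ∧ (d = b + 1 ∨ b = d + 1)) := by
    dsimp only at h
    rcases abs_cases (a - c) with h | h <;> rcases abs_cases (b - d) with h' | h' <;> omega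
  rcases h' with ⟨rfl, rfl | rfl⟩ | ⟨rfl, rfl | rfl⟩
  · exact h₁ b a
  · exact G.symm _ _ (h₁ b c)
  · exact h₂ a b
  · exact G.symm _ _ (h₂ a d)

theorem translate_mem_homShift {x : ℤ × ℤ → V} (hx : x ∈ G.homShift) (t : ℤ × ℤ) :
    (fun w => x (w + t)) ∈ G.homShift := fun u v h => hx _ _ (by simpa using h)

theorem swap_mem_homShift {x : ℤ × ℤ → V} (hx : x ∈ G.homShift) :
    (fun w : ℤ × ℤ => x w.swap) ∈ G.homShift := fun u v h => hx _ _ (by simpa [add_comm] using h)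

/-- The retraction of `ℤ` onto `[0, n]` that makes two letters alternate on both sides. -/
def clamp (n i : ℤ) : ℤ := if i < 0 then (-i) % 2 else if i ≤ n then i else n - (i - n) % 2

theorem clamp_of_mem {n i : ℤ} (h₀ : 0 ≤ i) (h₁ : i ≤ n) : clamp n i = i := by
  unfold clamp; rw [if_neg (by omega), if_pos h₁]

/-- Neighbours go to neighbours, so composing with `clamp` preserves rows. Alternating takes two
letters, hence `1 ≤ n`. -/
theorem clamp_succ {n : ℤ} (hn : 1 ≤ n) (i : ℤ) :
    clamp n (i + 1) = clamp n i + 1 ∨ clamp n i = clamp n (i + 1) + 1 := by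
  unfold clamp; split_ifs <;> omega

theorem clamp_left {n i : ℤ} (hn : 1 ≤ n) (hi : i + 2 ≤ 0) : clamp n (i + 2) = clamp n i := by
  unfold clamp; split_ifs <;> omega

theorem clamp_right {n i : ℤ} (hn : 1 ≤ n) (hi : n ≤ i) : clamp n (i + 2) = clamp n i := by
  unfold clamp; split_ifs <;> omega

/-- The configuration that agrees with `x` on `u + [0, n]²` and alternates around it. -/
def extend (n : ℤ) (u : ℤ × ℤ) (x : ℤ × ℤ → V) (w : ℤ × ℤ) : V :=
  x (u.1 + clamp n (w.1 - u.1), u.2 + clamp n (w.2 - u.2))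

theorem IsRow.clamp {w : ℤ → V} (hw : G.IsRow w) {n : ℤ} (hn : 1 ≤ n) (a : ℤ) :
    G.IsRow fun i => w (a + LoopGraph.clamp n (i - a)) := fun i => by
  dsimp only
  rw [show i + 1 - a = i - a + 1 by ring]
  rcases clamp_succ hn (i - a) with h | h
  · rw [h, ← add_assoc]; exact hw _
  · rw [h, ← add_assoc]; exact G.symm _ _ (hw _)

theorem extend_mem {n : ℤ} (hn : 1 ≤ n) (u : ℤ × ℤ) {x : ℤ × ℤ → V} (hx : x ∈ G.homShift) :
    extend n u x ∈ G.homShift := by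
  rw [mem_homShift] at hx ⊢
  exact ⟨fun k => (hx.1 (u.2 + clamp n (k - u.2))).clamp hn u.1,
    fun i => (hx.2 (u.1 + clamp n (i - u.1))).clamp hn u.2⟩

theorem extend_apply {n : ℤ} (u : ℤ × ℤ) (x : ℤ × ℤ → V) {i k : ℤ} (hi : 0 ≤ i) (hi' : i ≤ n)
    (hk : 0 ≤ k) (hk' : k ≤ n) : extend n u x (u + (i, k)) = x (u + (i, k)) := by
  simp [extend, clamp_of_mem, *, Prod.add_def]

theorem extend_left {n : ℤ} (hn : 1 ≤ n) (u : ℤ × ℤ) (x : ℤ × ℤ → V) (k i : ℤ)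
    (hi : i + 2 ≤ u.1) : extend n u x (i + 2, k) = extend n u x (i, k) := by
  unfold extend
  rw [show i + 2 - u.1 = i - u.1 + 2 by ring, clamp_left hn (by omega)]

theorem extend_right {n : ℤ} (hn : 1 ≤ n) (u : ℤ × ℤ) (x : ℤ × ℤ → V) (k i : ℤ)
    (hi : u.1 + n ≤ i) : extend n u x (i + 2, k) = extend n u x (i, k) := by
  unfold extend
  rw [show i + 2 - u.1 = i - u.1 + 2 by ring, clamp_right hn (by omega)]

/-- `x` and `x'` agree on `u + [0, n]²`, respectively on its translate by `v`. -/
def AgreeOn (n : ℤ) (u v : ℤ × ℤ) (x z : ℤ × ℤ → V) : Prop :=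
  ∀ i k, 0 ≤ i → i ≤ n → 0 ≤ k → k ≤ n → z (u + v + (i, k)) = x (u + (i, k))

/-- Two configurations are joined vertically by a sequence of successive rows. -/
theorem exists_join {x x' : ℤ × ℤ → V} (hx : x ∈ G.homShift) (hx' : x' ∈ G.homShift) (t : ℤ)
    (H : ℕ) (h : IterRel G.RowAdj H (fun i => x (i, t)) fun i => x' (i, t + H)) :
    ∃ z ∈ G.homShift, (∀ i k, k ≤ t → z (i, k) = x (i, k)) ∧
      ∀ i k, t + H ≤ k → z (i, k) = x' (i, k) := by
  obtain ⟨F, h0, hH, hF⟩ := h.exists_seq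
  let z : ℤ × ℤ → V := fun w => if w.2 ≤ t then x w else if w.2 ≤ t + H then F (w.2 - t).toNat w.1
    else x' w
  have z₂ : ∀ (i : ℤ) (s : ℕ), s ≤ H → z (i, t + s) = F s i := fun i s hs => by
    rcases Nat.eq_zero_or_pos s with rfl | hs0
    · simp [z, h0]
    · simp only [z]
      rw [if_neg (by omega), if_pos (by omega), show (t + s - t).toNat = s by omega]
  have z₁ : ∀ i k, k ≤ t → z (i, k) = x (i, k) := fun i k hk => if_pos hk
  have z₃ : ∀ i k, t + H ≤ k → z (i, k) = x' (i, k) := fun i k hk => by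
    rcases hk.eq_or_lt with rfl | hk
    · rw [z₂ i H le_rfl, hH]
    · simp only [z]; rw [if_neg (by omega), if_neg (by omega)]
  rw [mem_homShift] at hx hx'
  refine ⟨z, mem_homShift.mpr ⟨fun k i => ?_, fun i k => ?_⟩, z₁, z₃⟩
  · dsimp only
    by_cases h₁ : k ≤ t
    · rw [z₁ _ _ h₁, z₁ _ _ h₁]; exact hx.1 k i
    by_cases h₂ : t + H ≤ k
    · rw [z₃ _ _ h₂, z₃ _ _ h₂]; exact hx'.1 k i
    obtain ⟨s, rfl⟩ : ∃ s : ℕ, k = t + s := ⟨(k - t).toNat, by omega⟩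
    rw [z₂ _ _ (by omega), z₂ _ _ (by omega)]
    exact (hF s (by omega)).1 i
  · dsimp only
    by_cases h₁ : k < t
    · rw [z₁ _ _ h₁.le, z₁ _ _ (by omega)]; exact hx.2 i k
    by_cases h₂ : t + H ≤ k
    · rw [z₃ _ _ h₂, z₃ _ _ (by omega)]; exact hx'.2 i k
    obtain ⟨s, rfl⟩ : ∃ s : ℕ, k = t + s := ⟨(k - t).toNat, by omega⟩
    have := z₂ i (s + 1) (by omega)
    push_cast at this
    rw [z₂ _ _ (by omega), add_assoc, this]
    exact (hF s (by omega)).2.2 i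

theorem AgreeOn.swap {n : ℤ} {u v : ℤ × ℤ} {x z : ℤ × ℤ → V}
    (h : AgreeOn n u.swap v (fun w => x w.swap) z) :
    AgreeOn n u v.swap x fun w => z w.swap := fun i k hi hi' hk hk' => h k i hk hk' hi hi'

/-- Two square patterns of size `n + 1 ≤ 2 ^ j` can be glued at distance `O(j)`, up to a translation
by a vector of norm at most `1`. -/
theorem SquareDecomposable.exists_glue [Finite V] (hconn : G.Connected)
    (hsq : G.SquareDecomposable) :
    ∃ c₁ c₂ : ℕ, ∀ (j n : ℕ) (x x' : ℤ × ℤ → V) (u u' : ℤ × ℤ), x ∈ G.homShift →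
      x' ∈ G.homShift → 1 ≤ n → n < 2 ^ j →
      ((n + (c₁ * j + c₂) : ℕ) ≤ |u.1 - u'.1| ∨ (n + (c₁ * j + c₂) : ℕ) ≤ |u.2 - u'.2|) →
      ∃ z ∈ G.homShift, ∃ v : ℤ × ℤ, BlockGluing.supNorm v < 2 ∧
        AgreeOn n u 0 x z ∧ AgreeOn n u' v x' z := by
  obtain ⟨c₁, c₂, hc⟩ := hsq.exists_rowAdj hconn
  refine ⟨c₁, c₂, fun j n => ?_⟩
  obtain ⟨N, hN⟩ : ∃ N, N = n + (c₁ * j + c₂) := ⟨_, rfl⟩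
  rw [← hN]
  -- the first block is below the second one
  have below : ∀ (x x' : ℤ × ℤ → V) (u u' : ℤ × ℤ), x ∈ G.homShift → x' ∈ G.homShift →
      1 ≤ n → n < 2 ^ j → N ≤ u'.2 - u.2 → ∃ z ∈ G.homShift, ∃ e : ℤ, (e = 0 ∨ e = 1) ∧
        AgreeOn n u 0 x z ∧ AgreeOn n u' (e, 0) x' z := by
    intro x x' u u' hx hx' hn hnj hu
    have hn' : (1 : ℤ) ≤ n := by exact_mod_cast hn
    have hy := extend_mem hn' u hx
    have hy' := extend_mem hn' u' hx'
    -- The number of steps from the top row of the lower block to the bottom row of the upper one.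
    obtain ⟨H, hH⟩ : ∃ H : ℕ, (H : ℤ) = u'.2 - (u.2 + n) :=
      ⟨(u'.2 - (u.2 + n)).toNat, by omega⟩
    obtain ⟨e, he, h⟩ := hc j n H u.1 u'.1 (fun i => extend n u x (i, u.2 + n))
      (fun i => extend n u' x' (i, u'.2)) hnj (by omega) ((mem_homShift.mp hy).1 _)
      (fun i => extend_left hn' u x _ i) (fun i => extend_right hn' u x _ i)
      ((mem_homShift.mp hy').1 _) (fun i => extend_left hn' u' x' _ i)
      (fun i => extend_right hn' u' x' _ i)
    obtain ⟨z, hz, h₁, h₂⟩ := exists_join hy (translate_mem_homShift hy' (-e, 0)) (u.2 + n) H (by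
      convert h using 2
      rw [show u.2 + n + (H : ℤ) = u'.2 by omega]
      simp [sub_eq_add_neg])
    refine ⟨z, hz, e, he, fun i k hi hi' hk hk' => ?_, fun i k hi hi' hk hk' => ?_⟩
    · rw [← extend_apply u x hi hi' hk hk', add_zero]
      exact h₁ _ _ (by simpa using hk')
    · rw [← extend_apply u' x' hi hi' hk hk']
      refine (h₂ _ _ ?_).trans ?_
      · simp only [Prod.snd_add]; omega
      · congr 1
        ext <;> simp
        ring
  have vertical : ∀ (x x' : ℤ × ℤ → V) (u u' : ℤ × ℤ), x ∈ G.homShift → x' ∈ G.homShift →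
      1 ≤ n → n < 2 ^ j → N ≤ |u.2 - u'.2| → ∃ z ∈ G.homShift, ∃ v : ℤ × ℤ,
        BlockGluing.supNorm v < 2 ∧ AgreeOn n u 0 x z ∧ AgreeOn n u' v x' z := by
    intro x x' u u' hx hx' hn hnj hu
    rcases le_abs'.mp hu with hu | hu
    · obtain ⟨z, hz, e, he, h₁, h₂⟩ := below x x' u u' hx hx' hn hnj (by omega)
      exact ⟨z, hz, (e, 0), by rcases he with rfl | rfl <;> simp [BlockGluing.supNorm], h₁, h₂⟩
    · obtain ⟨z, hz, e, he, h₁, h₂⟩ := below x' x u' u hx' hx hn hnj hu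
      -- Here the first block is the upper one and carries the shift; translating the whole
      -- configuration passes it, with opposite sign, to the other block.
      refine ⟨_, translate_mem_homShift hz (e, 0), (-e, 0),
        by rcases he with rfl | rfl <;> simp [BlockGluing.supNorm],
        fun i k hi hi' hk hk' => ?_, fun i k hi hi' hk hk' => ?_⟩
      · rw [← h₂ i k hi hi' hk hk']
        dsimp only
        congr 1; ext <;> simp; ring
      · rw [← h₁ i k hi hi' hk hk']
        dsimp only
        congr 1; ext <;> simp; ring
  intro x x' u u' hx hx' hn hnj hu
  rcases hu with hu | hu
  · obtain ⟨z, hz, v, hv, h₁, h₂⟩ := vertical _ _ u.swap u'.swap (swap_mem_homShift hx)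
      (swap_mem_homShift hx') hn hnj hu
    exact ⟨_, swap_mem_homShift hz, v.swap, by rwa [BlockGluing.supNorm, max_comm], h₁.swap,
      h₂.swap⟩
  · exact vertical x x' u u' hx hx' hn hnj hu

/-- In a square-decomposable graph, a closed walk has even length. -/
theorem SquareDecomposable.even_of_closed (hsq : G.SquareDecomposable) {w : ℤ → V}
    (hw : G.IsRow w) (L : ℕ) (h : w L = w 0) : L % 2 = 0 := by
  have hc : G.IsCycle (segment w 0 L) := by
    refine ⟨⟨fun h => ?_, segment_isChain fun k _ => hw _⟩, ?_⟩
    · have := segment_length w 0 L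
      simp [h] at this
    · rw [segment_head?, segment_getLast?, zero_add, h]
  obtain ⟨v, -, hv⟩ := hsq.htpy_of_isCycle hc
  have := hv.length_mod
  rw [segment_length] at this
  simp only [List.length_singleton] at this
  omega

end LoopGraph

/-! ### Distance between blocks and existence of the gap function -/

namespace BlockGluing

/-- Far away blocks are far away in one of the two directions. -/
theorem le_abs_of_le_setDist {n : ℕ+} {u u' : ℤ × ℤ} {d : ℕ}
    (h : d + 1 ≤ setDist (block n u) (block n u')) :
    ((n + d : ℕ) : ℤ) ≤ |u.1 - u'.1| ∨ ((n + d : ℕ) : ℤ) ≤ |u.2 - u'.2| := by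
  by_contra! hc
  obtain ⟨h₁, h₂⟩ := hc
  have key : ∀ a : ℤ, |a| < ((n + d : ℕ) : ℤ) → ∃ i i' : Fin n, (a + i - i').natAbs ≤ d := by
    intro a ha
    rw [abs_lt] at ha
    push_cast at ha
    have hn := n.pos
    rcases le_total 0 a with h | h
    · exact ⟨⟨0, hn⟩, ⟨min a.toNat (n - 1), by omega⟩, by push_cast; omega⟩
    · exact ⟨⟨min (-a).toNat (n - 1), by omega⟩, ⟨0, hn⟩, by push_cast; omega⟩
  obtain ⟨i, i', hi⟩ := key _ h₁
  obtain ⟨k, k', hk⟩ := key _ h₂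
  have : setDist (block n u) (block n u') ≤
      supNorm (u + ((i : ℤ), (k : ℤ)) - (u' + ((i' : ℤ), (k' : ℤ)))) :=
    Nat.sInf_le ⟨_, ⟨i, k, rfl⟩, _, ⟨i', k', rfl⟩, rfl⟩
  have h' : supNorm (u + ((i : ℤ), (k : ℤ)) - (u' + ((i' : ℤ), (k' : ℤ)))) ≤ d := by
    unfold supNorm
    refine max_le ?_ ?_
    · simp only [Prod.fst_sub, Prod.fst_add]; omega
    · simp only [Prod.snd_sub, Prod.snd_add]; omega
  omega

variable {A : Type*} {X : Set (ℤ × ℤ → A)}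

/-- For a given phase, there is a pointwise least gluing function. -/
theorem IsPhasedGluing.exists_isLeast {f : ℕ+ → ℕ} {k : ℕ} (h : IsPhasedGluing X f k) :
    ∃ γ, IsLeast {f : ℕ+ → ℕ | IsPhasedGluing X f k} γ := by
  refine ⟨fun n => sInf ((fun f => f n) '' {f : ℕ+ → ℕ | IsPhasedGluing X f k}), ?_, ?_⟩
  · intro n p p' hp hp' u u' hd
    -- Gluing of blocks of size `n` only depends on the value at `n`, so a different function may
    -- attain the infimum for each `n`.
    obtain ⟨g, hg, hgn⟩ := Nat.sInf_mem (Set.Nonempty.image (fun f : ℕ+ → ℕ => f n)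
      (s := {f : ℕ+ → ℕ | IsPhasedGluing X f k}) ⟨f, h⟩)
    exact hg n p p' hp hp' u u' (hgn.trans_le hd)
  · exact fun g hg n => Nat.sInf_le ⟨g, hg, rfl⟩

theorem IsPhasedGluing.exists_isGapFunction {f : ℕ+ → ℕ} {k : ℕ} (h : IsPhasedGluing X f k)
    (hk : IsPhase X k) : ∃ γ, IsGapFunction X γ ∧ ∀ n, γ n ≤ f n := by
  obtain ⟨γ, hγ⟩ := h.exists_isLeast
  exact ⟨γ, ⟨k, hk, hγ⟩, hγ.2 h⟩

end BlockGluing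

/-! ### The phase and the logarithmic bound -/

namespace LoopGraph

variable {V : Type*} {G : LoopGraph V}

open BlockGluing

theorem exists_appearsAt {n : ℕ+} {p : Fin n × Fin n → V} (hp : GloballyAdmissible G.homShift p)
    (u : ℤ × ℤ) : ∃ x ∈ G.homShift, AppearsAt p x u := by
  obtain ⟨x, hx, t, h⟩ := hp
  refine ⟨_, translate_mem_homShift hx (t - u), fun i j => ?_⟩
  rw [← h i j]
  congr 1; ring

theorem AgreeOn.appearsAt {n : ℕ+} {p : Fin n × Fin n → V} {x z : ℤ × ℤ → V} {u v : ℤ × ℤ}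
    (h : AgreeOn (n : ℕ) u v x z) (hp : AppearsAt p x u) : AppearsAt p z (u + v) :=
  fun i j => by
    rw [← hp i j]
    exact h i j (by omega) (by omega) (by omega) (by omega)

theorem SquareDecomposable.isPhasedGluing [Finite V] (hconn : G.Connected)
    (hsq : G.SquareDecomposable) :
    ∃ c₁ c₂ : ℕ, IsPhasedGluing G.homShift (fun n => c₁ * Nat.clog 2 (n + 1) + c₂) 2 := by
  obtain ⟨c₁, c₂, hc⟩ := hsq.exists_glue hconn
  -- The extra 1 compensates for blocks of size `n` having extent `n - 1`. They are glued as parts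
  -- of `[0, n]²`, so that size 1 is covered as well.
  refine ⟨c₁, c₂ + 1, fun n p p' hp hp' u u' hd => ?_⟩
  obtain ⟨x, hx, hxp⟩ := exists_appearsAt hp u
  obtain ⟨x', hx', hxp'⟩ := exists_appearsAt hp' u'
  obtain ⟨z, hz, v, hv, h₁, h₂⟩ := hc (Nat.clog 2 (n + 1)) n x x' u u' hx hx' n.pos
    (Nat.lt_of_succ_le (Nat.le_pow_clog one_lt_two _)) (le_abs_of_le_setDist hd)
  exact ⟨z, hz, v, hv, by simpa using h₁.appearsAt hxp, h₂.appearsAt hxp'⟩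

theorem SquareDecomposable.not_isPhasedGluing_one (hsq : G.SquareDecomposable)
    (hne : G.homShift.Nonempty) (f : ℕ+ → ℕ) : ¬ IsPhasedGluing G.homShift f 1 := by
  obtain ⟨x, hx⟩ := hne
  intro h
  have hp : GloballyAdmissible G.homShift (n := 1) fun _ => x 0 := by
    refine ⟨x, hx, 0, fun i j => ?_⟩
    have hi := i.2
    have hj := j.2
    simp only [PNat.one_coe, Nat.lt_one_iff] at hi hj
    simp [hi, hj, ← Prod.zero_eq_mk]
  -- With phase 1 the same letter would occur twice in a row, at the odd distance `2 * f 1 + 1 ≥ f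
  -- 1`; the row between would be an odd closed walk.
  obtain ⟨z, hz, v, hv, h₁, h₂⟩ := h 1 _ _ hp hp 0 ((2 * f 1 + 1 : ℕ), 0) (by
    refine le_csInf ⟨_, _, ⟨0, 0, rfl⟩, _, ⟨0, 0, rfl⟩, rfl⟩ ?_
    rintro d ⟨_, ⟨i, j, rfl⟩, _, ⟨i', j', rfl⟩, rfl⟩
    refine le_max_of_le_left ?_
    have hi := i.2
    have hi' := i'.2
    simp only [PNat.one_coe, Nat.lt_one_iff] at hi hi'
    simp only [hi, hi', Prod.fst_sub, Prod.fst_add, Prod.fst_zero]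
    omega)
  obtain rfl : v = 0 := by
    unfold supNorm at hv
    ext <;> simp <;> omega
  have e₁ := h₁ 0 0
  have e₂ := h₂ 0 0
  have := hsq.even_of_closed ((mem_homShift.mp hz).1 0) (2 * f 1 + 1) (by
    simp at e₁ e₂
    simpa [← Prod.zero_eq_mk] using e₂.trans e₁.symm)
  omega

theorem clog_le_log (n : ℕ) (hn : 0 < n) :
    (Nat.clog 2 (n + 1) : ℝ) ≤ Real.log n / Real.log 2 + 1 := by
  have h2 : 0 < Real.log 2 := Real.log_pos one_lt_two
  have h := Nat.pow_pred_clog_lt_self one_lt_two (show 1 < n + 1 by omega)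
  have hpos : 0 < Nat.clog 2 (n + 1) := Nat.clog_pos one_lt_two (by omega)
  obtain ⟨j, hj⟩ : ∃ j, Nat.clog 2 (n + 1) = j + 1 := ⟨_, (Nat.succ_pred_eq_of_pos hpos).symm⟩
  rw [hj] at h ⊢
  have h' : ((2 : ℝ) ^ j) ≤ n := by exact_mod_cast Nat.lt_succ_iff.mp h
  have := Real.log_le_log (by positivity) h'
  rw [Real.log_pow] at this
  push_cast
  gcongr
  rwa [le_div_iff₀ h2]

end LoopGraph

theorem mainTheorem3 {V : Type*} [Finite V] (G : LoopGraph V) (hconn : G.Connected)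
    (hsq : G.SquareDecomposable) :
    ∃ γ : ℕ+ → ℕ, BlockGluing.IsGapFunction G.homShift γ ∧
      ∃ c K : ℝ, 0 < c ∧ 0 < K ∧ ∀ n : ℕ+, (γ n : ℝ) ≤ c * Real.log (n : ℝ) + K := by
  -- If the Hom shift is empty, no pattern is admissible: the phase is 1 and the gap function is
  -- zero.
  rcases G.homShift.eq_empty_or_nonempty with he | hne
  · have h : BlockGluing.IsPhasedGluing G.homShift (fun _ => 0) 1 := by
      rintro n p p' ⟨x, hx, -⟩
      simp [he] at hx
    obtain ⟨γ, hγ, hle⟩ := h.exists_isGapFunction ⟨⟨le_rfl, _, h⟩, fun k hk => hk.1⟩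
    refine ⟨γ, hγ, 1, 1, one_pos, one_pos, fun n => ?_⟩
    rw [Nat.le_zero.mp (hle n), one_mul, Nat.cast_zero]
    have : 0 ≤ Real.log (n : ℝ) := Real.log_natCast_nonneg _
    linarith
  · obtain ⟨c₁, c₂, h⟩ := hsq.isPhasedGluing hconn
    obtain ⟨γ, hγ, hle⟩ := h.exists_isGapFunction ⟨⟨one_le_two, _, h⟩, fun k hk => by
      obtain ⟨hk, f, hf⟩ := hk
      by_contra hlt
      obtain rfl : k = 1 := by omega
      exact hsq.not_isPhasedGluing_one hne f hf⟩
    have h2 : 0 < Real.log 2 := Real.log_pos one_lt_two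
    refine ⟨γ, hγ, c₁ / Real.log 2 + 1, c₁ + c₂ + 1, by positivity, by positivity, fun n => ?_⟩
    have h₁ : (γ n : ℝ) ≤ c₁ * Nat.clog 2 (n + 1) + c₂ := by exact_mod_cast hle n
    have h₂ := mul_le_mul_of_nonneg_left (LoopGraph.clog_le_log n n.pos)
      (Nat.cast_nonneg (α := ℝ) c₁)
    have h₃ : 0 ≤ Real.log (n : ℝ) := Real.log_natCast_nonneg _
    calc (γ n : ℝ) ≤ c₁ * (Real.log n / Real.log 2 + 1) + c₂ := by linarith
      _ = c₁ / Real.log 2 * Real.log n + (c₁ + c₂) := by ring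
      _ ≤ _ := by linarith
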